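/- Let $d$ be a positive integer and let $\mathscr T_1,\dots,\mathscr T_d$ be locally finite, leafless, rooted directed trees, $\mathscr T_j=(V_j,\mathcal E_j)$ with root $\mathsf{root}_j$, each having finite branching index (the depths of the vertices of $\mathscr T_j$ with at least two children are bounded). Put $V=V_1\times\cdots\times V_d$ and $\mathsf{root}=(\mathsf{root}_1,\dots,\mathsf{root}_d)$. For $v\in V$ let $\mathsf d_v\in\mathbb N^d$ be the multiindex whose $j$-th entry $\mathsf d_{v_j}$ is the depth of $v_j$ in $\mathscr T_j$, let $|\mathsf d_v|$ be the sum of its entries, and let $\mathsf{Chi}_j(v)$ be the set of the vertices obtained from $v$ by replacing $v_j$ by one of its children. A weight system $(\lambda_j(w))$ (where $w_j\ne\mathsf{root}_j$) with $\sup_v\sum_{w\in\mathsf{Chi}_j(v)}\lambda_j(w)^2<\infty$ for every $j$ defines the bounded multishift $S=(S_1,\dots,S_d)$ on $l^2(V)$, $S_je_v=\sum_{w\in\mathsf{Chi}_j(v)}\lambda_j(w)e_w$. Let $a$ be a positive integer with $a<d$. Let $S_{\lambda_{\mathfrak c_a}}$ be the Drury–Arveson-type multishift, with weights $$\lambda_j(w)=\frac{1}{\sqrt{\operatorname{card}\mathsf{Chi}_j(v)}}\sqrt{\frac{\mathsf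 d_{v_j}+1}{|\mathsf d_v|+a}},\qquad w\in\mathsf{Chi}_j(v),$$ and let $S^{\mathfrak s}$ be its spherical Cauchy dual, the multishift with weights $\lambda^{\mathfrak s}_j(w)=\lambda_j(w)\big(\sum_{i=1}^d\|S_ie_v\|^2\big)^{-1}$, $w\in\mathsf{Chi}_j(v)$, where $S_1,\dots,S_d$ are the components of $S_{\lambda_{\mathfrak c_a}}$. Let $E=\bigcap_j\ker (S^{\mathfrak s}_j)^*$. The Cauchy dual module $\mathscr H^{\mathfrak s}_{\mathfrak c_a}(\mathscr T)$ (the analytic model of $S^{\mathfrak s}$) is the space of the $E$-valued functions $F(z)=\sum_{\alpha\in\mathbb N^d}f_\alpha z^\alpha$ on the unit ball $\mathbb B^d$ of $\mathbb C^d$ with $\sum_\alpha\|(S^{\mathfrak s})^\alpha f_\alpha\|^2<\infty$, with inner product $\langle F,G\rangle=\sum_\alpha\langle (S^{\mathfrak s})^\alpha f_\alpha,(S^{\mathfrak s})^\alpha g_\alpha\rangle$. For $F\subseteq\{1,\dots,d\}$ let $\Phi_F=\{v\in V: v_j\neq\mathsf{root}_j\text{ if and only if }j\in F\}$. For $u\in\Phi_F$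 let $\mathsf{sib}_F(u)$ be the set of the $v\in V$ such that $v_j$ has the same parent as $u_j$ for $j\in F$ and $v_j=u_j$ for $j\notin F$. Let $\Omega_F\subseteq\Phi_F$ contain exactly one element of each of the classes $\mathsf{sib}_F(u)$. For $u\in\Omega_F$ let $\mathcal L_{u,F}\subseteq E$ be the space of the $f\in l^2(\mathsf{sib}_F(u))$ such that, for all $j\in F$ and $v\in\mathsf{sib}_F(u)$, $\sum_{w}f(w)\lambda^{\mathfrak s}_j(w)=0$, where $w$ runs through the elements of $\mathsf{sib}_F(u)$ with $w_i=v_i$ for all $i\neq j$. For $l\in\mathbb N$ and $s\in[0,1]$ put $$\omega_l(s)=(l+a)\cdots(l+d-1)\sum_{i=a}^{d-1}\frac{s^{i+l-1}}{\prod_{a\le j\ne i\le d-1}(j-i)},$$ and for $u\in\Omega_F$ let $$d\rho_u(s)=\omega_{|\mathsf d_u|}(s)\,dm(s),\qquad d\nu_u(z)=\frac{|z^{\mathsf d_u}|^2}{\|z^{\mathsf d_u}\|^2_{L^2(\partial\mathbb B^d,\sigma)}}\,d\sigma(z),$$ where $m$ is the Lebesgue measure on $[0,1]$ and $\sigma$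 is the normalized surface area measure on $\partial\mathbb B^d$. Then $\omega_l\ge 0$ on $[0,1]$ for every $l\in\mathbb N$, and $\mathscr H^{\mathfrak s}_{\mathfrak c_a}(\mathscr T)$ admits the representing measure $(\rho_u\times\nu_u)_{u\in\Omega_F,\,F\subseteq\{1,\dots,d\}}$. That is, the measures $\rho_u$ and $\nu_u$ are finite, and there is a measure $\mu$ on $\mathbb R\times\partial\mathbb B^d$ whose values are positive operators in $B(E)$, supported on $[0,1]\times\partial\mathbb B^d$, such that (i) for all $f\in E$ and $\alpha\in\mathbb N^d$, the function $s^{|\alpha|}|z^\alpha|^2$ is integrable for $\langle d\mu f,f\rangle$ and $$\|z^\alpha f\|^2_{\mathscr H^{\mathfrak s}_{\mathfrak c_a}(\mathscr T)}=\int_{[0,1]\times\partial\mathbb B^d}s^{|\alpha|}|z^\alpha|^2\,\langle d\mu(s,z)f,f\rangle;$$ (ii) $\mu(A)\big(\sum_{F}\sum_{u\in\Omega_F}g_{u,F}\big)=\sum_{F}\sum_{u\in\Omega_F}(\rho_u\times\nu_u)(A)\,g_{u,F}$ for every Borel set $A$ and all $g_{u,F}\in\mathcal L_{u,F}$ for which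 the sum on the left converges; (iii) $\rho_{\mathsf{root}}$ and $\nu_{\mathsf{root}}$ are probability measures. -/

import Mathlib

open MeasureTheory

noncomputable section

/-! ### Rooted directed trees -/

/-- A rooted directed tree: `Adj u v` means that `(u, v)` is a directed edge. The root has no parent,
every other vertex has exactly one parent, and every vertex is reached from the root by a directed
path. (Equivalently: a connected directed graph without circuits in which every vertex has at most
one parent, and in which `root` is the vertex without a parent.) -/
structure RootedDirectedTree (V : Type*) extends Digraph V where
  root : V
  not_adj_root : ∀ u, ¬ Adj u root
  existsUnique_parent : ∀ v, v ≠ root → ∃! u, Adj u v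
  reachable : ∀ v, Relation.ReflTransGen Adj root v

namespace RootedDirectedTree

variable {V : Type*} (T : RootedDirectedTree V)

/-- `Chi(v)`. -/
def children (v : V) : Set V := {w | T.Adj v w}

open Classical in
/-- `par(v)`; it is only used for `v ≠ root` (and is set to be `root` at the root). -/
def parent (v : V) : V :=
  if h : v = T.root then T.root else (T.existsUnique_parent v h).choose

/-- `Chi^n(root)`: the vertices that can be reached from the root by a path with `n` edges. -/
def generation : ℕ → Set V
  | 0 => {T.root}
  | n + 1 => {w | ∃ v ∈ generation n, T.Adj v w}

theorem exists_mem_generation (v : V) : ∃ n, v ∈ T.generation n := by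
  induction T.reachable v with
  | refl => exact ⟨0, rfl⟩
  | tail _ h ih => exact ih.elim fun n hn => ⟨n + 1, _, hn, h⟩

open Classical in
/-- The depth of a vertex: the (unique) `n` with `v ∈ Chi^n(root)`. -/
def depth (v : V) : ℕ := Nat.find (T.exists_mem_generation v)

/-- Every vertex has at least one child. -/
def Leafless : Prop := ∀ v, (T.children v).Nonempty

/-- Every vertex has finitely many children. -/
def LocallyFinite : Prop := ∀ v, (T.children v).Finite

/-- The branching index: `1 + sup` of the depths of the vertices with at least two children, and `0`
if there is no such vertex. -/
def branchingIndex : ℕ∞ := ⨆ w ∈ {v : V | (T.children v).Nontrivial}, ((T.depth w : ℕ∞) + 1)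

end RootedDirectedTree

/-! ### The directed Cartesian product and its multishifts -/

/-- `l^2(X)`. -/
abbrev SqSum (X : Type*) := lp (fun _ : X => ℂ) 2

namespace TreeProduct

variable {d : ℕ} {V : Fin d → Type*} (T : ∀ j, RootedDirectedTree (V j))

/-- The root of the product. -/
def root : ∀ j, V j := fun j => (T j).root

/-- `par_j(v)`, for `v` with `v_j ≠ root_j`. -/
def par (j : Fin d) (v : ∀ i, V i) : ∀ i, V i := Function.update v j ((T j).parent (v j))

/-- `Chi_j(v)`. -/
def chi (j : Fin d) (v : ∀ i, V i) : Set (∀ i, V i) :=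
  {w | ∃ η ∈ (T j).children (v j), w = Function.update v j η}

/-- `sib_j(v) = Chi_j(par_j(v))`, for `v` with `v_j ≠ root_j`. -/
def sib (j : Fin d) (v : ∀ i, V i) : Set (∀ i, V i) := chi T j (par T j v)

/-- The depth `d_v`, a multiindex. -/
def depth (v : ∀ i, V i) : Fin d → ℕ := fun j => (T j).depth (v j)

/-- `|d_v|`. -/
def level (v : ∀ i, V i) : ℕ := ∑ j, depth T v j

/-- The product of the trees has finite joint branching index: `(k_{T_1}, …, k_{T_d})` lies
in `ℕ^d`. -/
def FiniteJointBranchingIndex : Prop := ∀ j, (T j).branchingIndex ≠ ⊤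

open Classical in
/-- The mapping `Λ^{(j)}` on complex functions on the set of vertices of the product. -/
def shiftFun (lam : Fin d → (∀ i, V i) → ℝ) (j : Fin d) (f : (∀ i, V i) → ℂ) (v : ∀ i, V i) : ℂ :=
  if v j = (T j).root then 0 else (lam j v : ℂ) * f (par T j v)

/-- `sup_v ∑_{w ∈ Chi_j(v)} λ_j(w)^2 ≤ C` (the sum is bounded through its finite partial sums). -/
def WeightBound (lam : Fin d → (∀ i, V i) → ℝ) (j : Fin d) (C : ℝ) : Prop :=
  0 ≤ C ∧ ∀ (v : ∀ i, V i) (s : Finset (∀ i, V i)), (s : Set (∀ i, V i)) ⊆ chi T j v →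
    ∑ w ∈ s, lam j w ^ 2 ≤ C

theorem mem_chi_par {j : Fin d} {v : ∀ i, V i} (h : v j ≠ (T j).root) : v ∈ chi T j (par T j v) := by
  refine ⟨v j, ?_, by simp [par]⟩
  simp only [par, Function.update_self, RootedDirectedTree.children, Set.mem_ofPred_eq,
    RootedDirectedTree.parent, h, dite_false]
  exact ((T j).existsUnique_parent (v j) h).choose_spec.1

theorem sum_shiftFun_le {lam : Fin d → (∀ i, V i) → ℝ} {j : Fin d} {C : ℝ}
    (h : WeightBound T lam j C) (f : SqSum (∀ i, V i)) (s : Finset (∀ i, V i)) :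
    ∑ v ∈ s, ‖shiftFun T lam j f v‖ ^ 2 ≤ C * ‖f‖ ^ 2 := by
  classical
  set s' := s.filter fun v => v j ≠ (T j).root with hs'
  have h1 : ∑ v ∈ s, ‖shiftFun T lam j f v‖ ^ 2
      = ∑ v ∈ s', lam j v ^ 2 * ‖f (par T j v)‖ ^ 2 := by
    rw [hs', Finset.sum_filter]
    refine Finset.sum_congr rfl fun v _ => ?_
    by_cases hv : v j = (T j).root <;> simp [shiftFun, hv, mul_pow]
  have h2 : ∑ v ∈ s', lam j v ^ 2 * ‖f (par T j v)‖ ^ 2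
      = ∑ u ∈ s'.image (par T j), (∑ v ∈ s' with par T j v = u, lam j v ^ 2) * ‖f u‖ ^ 2 := by
    rw [← Finset.sum_fiberwise_of_maps_to (fun v hv => Finset.mem_image_of_mem (par T j) hv)]
    refine Finset.sum_congr rfl fun u _ => ?_
    rw [Finset.sum_mul]
    refine Finset.sum_congr rfl fun v hv => ?_
    rw [(Finset.mem_filter.1 hv).2]
  have h3 : ∀ u, ∑ v ∈ s' with par T j v = u, lam j v ^ 2 ≤ C := fun u => by
    refine h.2 u _ fun v hv => ?_
    simp only [hs', Finset.coe_filter, Finset.mem_filter, Set.mem_ofPred_eq] at hv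
    rw [← hv.2]
    exact mem_chi_par T hv.1.2
  rw [h1, h2]
  calc _ ≤ ∑ u ∈ s'.image (par T j), C * ‖f u‖ ^ 2 :=
        Finset.sum_le_sum fun u _ => mul_le_mul_of_nonneg_right (h3 u) (by positivity)
    _ = C * ∑ u ∈ s'.image (par T j), ‖f u‖ ^ 2 := by rw [Finset.mul_sum]
    _ ≤ C * ‖f‖ ^ 2 := by
        refine mul_le_mul_of_nonneg_left ?_ h.1
        have := lp.sum_rpow_le_norm_rpow (p := 2) (by norm_num) f (s'.image (par T j))
        simpa using this

theorem shiftFun_memlp {lam : Fin d → (∀ i, V i) → ℝ} {j : Fin d} {C : ℝ}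
    (h : WeightBound T lam j C) (f : SqSum (∀ i, V i)) :
    Memℓp (shiftFun T lam j f) 2 := by
  refine memℓp_gen' (C := C * ‖f‖ ^ 2) fun s => ?_
  simpa using sum_shiftFun_le T h f s

/-- The bounded operator `S_j f = Λ^{(j)} f`. -/
def boundedShift {lam : Fin d → (∀ i, V i) → ℝ} {j : Fin d} {C : ℝ}
    (h : WeightBound T lam j C) : SqSum (∀ i, V i) →L[ℂ] SqSum (∀ i, V i) :=
  LinearMap.mkContinuous
    { toFun := fun f => (⟨shiftFun T lam j f, shiftFun_memlp T h f⟩ : SqSum (∀ i, V i))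
      map_add' := fun f g => by
        ext v
        change shiftFun T lam j (f + g : SqSum _) v = shiftFun T lam j f v + shiftFun T lam j g v
        by_cases hv : v j = (T j).root <;> simp [shiftFun, hv, mul_add]
      map_smul' := fun c f => by
        ext v
        by_cases hv : v j = (T j).root <;> simp [shiftFun, hv, mul_left_comm] }
    (Real.sqrt C) fun f => by
      refine lp.norm_le_of_forall_sum_le (p := 2) (by norm_num) (by positivity) fun s => ?_
      have := sum_shiftFun_le T h f s
      simpa [mul_pow, Real.sq_sqrt h.1] using this

open Classical in
/-- The multishift `(S_1, …, S_d)` with weights `lam` on the product of the trees. The operator `S_j`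
is bounded if and only if `sup_v ∑_{w ∈ Chi_j(v)} λ_j(w)^2 < ∞`; only bounded ones are considered
(and otherwise the value is irrelevant). -/
def multishift (lam : Fin d → (∀ i, V i) → ℝ) (j : Fin d) :
    SqSum (∀ i, V i) →L[ℂ] SqSum (∀ i, V i) :=
  if h : ∃ C, WeightBound T lam j C then boundedShift T h.choose_spec else 0

open Classical in
/-- The weights of the spherical Cauchy dual of the multishift with weights `lam`:
`λ_j(w) (∑_i ‖S_i e_v‖^2)⁻¹` for `w ∈ Chi_j(v)`. -/
def cauchyDualWeight (lam : Fin d → (∀ i, V i) → ℝ) (j : Fin d) (w : ∀ i, V i) : ℝ :=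
  lam j w * (∑ i, ‖multishift T lam i (lp.single 2 (par T j w) (1 : ℂ))‖ ^ 2)⁻¹

/-- The weight system `λ_c` of a sequence `c`: for `w ∈ Chi_j(v)`,
`λ_j(w) = √(c(|d_v|) / card Chi_j(v)) √((d_{v_j} + 1) / (|d_v| + d))`. -/
def balancedWeight (c : ℕ → ℝ) (j : Fin d) (w : ∀ i, V i) : ℝ :=
  Real.sqrt (c (level T (par T j w)) / ((chi T j (par T j w)).ncard : ℝ)) *
    Real.sqrt (((depth T (par T j w) j : ℝ) + 1) / ((level T (par T j w) : ℝ) + d))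

/-- The weights of the Drury-Arveson-type multishift: `λ_c` with `c(t) = (t + d) / (t + a)`. -/
def druryArvesonWeight (a : ℕ) : Fin d → (∀ i, V i) → ℝ :=
  balancedWeight T fun t => ((t : ℝ) + d) / ((t : ℝ) + a)

/-! ### The decomposition of the joint cokernel -/

/-- `Φ_F`. -/
def phi (F : Finset (Fin d)) : Set (∀ i, V i) :=
  {v | (∀ j ∈ F, v j ≠ (T j).root) ∧ ∀ j ∉ F, v j = (T j).root}

/-- `sib_F(u)`, for `u ∈ Φ_F`: all coordinates in `F` are replaced by siblings. -/
def sibF (F : Finset (Fin d)) (u : ∀ i, V i) : Set (∀ i, V i) :=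
  {v | (∀ j ∈ F, v j ∈ (T j).children ((T j).parent (u j))) ∧ ∀ j ∉ F, v j = u j}

/-- `Ω_F ⊆ Φ_F` contains exactly one element of each class `sib_F(u)`, `u ∈ Φ_F`. -/
def IsIndexingSet (F : Finset (Fin d)) (Om : Set (∀ i, V i)) : Prop :=
  Om ⊆ phi T F ∧ ∀ v ∈ phi T F, ∃! u, u ∈ Om ∧ u ∈ sibF T F v

open Classical in
/-- `v_G`: the coordinates outside `G` are replaced by roots. -/
def proj (G : Finset (Fin d)) (v : ∀ i, V i) : ∀ i, V i :=
  fun j => if j ∈ G then v j else (T j).root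

/-- The space `L_{u,F} ⊆ l^2(sib_F(u))` of the solutions of
`∑_{w ∈ sib_j(v_G | u_j)} f(w) λ_j(w) = 0`, where `j ∈ F`, `G = F \ {j}` and `v_G` runs through
`{v_G : v ∈ sib_F(u)}`; here `v_G | u_j` is `v_G` with `u_j` put in the place `j`. The sums are finite
for locally finite trees. -/
def solutionSpace (lam : Fin d → (∀ i, V i) → ℝ) (F : Finset (Fin d)) (u : ∀ i, V i) :
    Set (SqSum (∀ i, V i)) :=
  {f | (∀ w, w ∉ sibF T F u → f w = 0) ∧
    ∀ j ∈ F, ∀ v ∈ sibF T F u,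
      ∑ᶠ w ∈ sib T j (Function.update (proj T (F.erase j) v) j (u j)), f w * (lam j w : ℂ) = 0}

end TreeProduct

/-! ### The analytic model of a tuple of operators -/

/-- The monomial `z^α`. -/
def zpowMulti {d : ℕ} (z : EuclideanSpace ℂ (Fin d)) (α : Fin d → ℕ) : ℂ := ∏ i, z i ^ α i

/-- The open unit ball of `ℂ^d`. -/
abbrev CBall (d : ℕ) := Metric.ball (0 : EuclideanSpace ℂ (Fin d)) 1

/-- The unit sphere of `ℂ^d`. -/
abbrev CSphere (d : ℕ) := Metric.sphere (0 : EuclideanSpace ℂ (Fin d)) 1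

/-- A power series in `d` variables which converges to zero on the unit ball has zero
coefficients. -/
theorem scalar_coeff_eq_zero {d : ℕ} (c : (Fin d → ℕ) → ℂ)
    (h : ∀ z : CBall d, HasSum (fun α => zpowMulti z.1 α * c α) 0) : c = 0 := by
  classical
  -- the homogeneous parts vanish on the ball
  have key : ∀ (n : ℕ) (z : CBall d),
      ∑ α ∈ Finset.piAntidiag Finset.univ n, zpowMulti z.1 α * c α = 0 := by
    intro n z
    set p : ℕ → ℂ := fun n => ∑ α ∈ Finset.piAntidiag Finset.univ n, zpowMulti z.1 α * c α with hp
    have hsum : ∀ t : ℂ, ‖t‖ ≤ 1 → HasSum (fun n => t ^ n * p n) 0 := by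
      intro t ht
      have hmem : t • z.1 ∈ Metric.ball (0 : EuclideanSpace ℂ (Fin d)) 1 := by
        have hz := mem_ball_zero_iff.1 z.2
        rw [mem_ball_zero_iff, norm_smul]
        calc ‖t‖ * ‖z.1‖ ≤ 1 * ‖z.1‖ := by gcongr
          _ < 1 := by simpa using hz
      have h0 := h ⟨t • z.1, hmem⟩
      have h1 := (Equiv.sigmaFiberEquiv fun α : Fin d → ℕ => ∑ i, α i).hasSum_iff.2 h0
      have hg : ∀ m : ℕ, HasSum (fun x : {α : Fin d → ℕ // ∑ i, α i = m} =>
          zpowMulti (t • z.1) x.1 * c x.1) (t ^ m * p m) := by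
        intro m
        have hset : {α : Fin d → ℕ | ∑ i, α i = m}
            = ((Finset.piAntidiag Finset.univ m : Finset (Fin d → ℕ)) : Set (Fin d → ℕ)) := by
          ext α; simp
        have e : t ^ m * p m = ∑ α ∈ Finset.piAntidiag Finset.univ m,
            zpowMulti (t • z.1) α * c α := by
          rw [hp, Finset.mul_sum]
          refine Finset.sum_congr rfl fun α hα => ?_
          have hα' : ∑ i, α i = m := by simpa using hα
          simp only [zpowMulti, PiLp.smul_apply, smul_eq_mul, mul_pow, Finset.prod_mul_distrib,
            Finset.prod_pow_eq_pow_sum, hα']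
          ring
        rw [e]
        have := Finset.hasSum (Finset.piAntidiag Finset.univ m)
          (fun α : Fin d → ℕ => zpowMulti (t • z.1) α * c α)
        exact (Equiv.hasSum_iff (Equiv.setCongr hset)).2 this
      exact HasSum.sigma h1 hg
    set q : FormalMultilinearSeries ℂ ℂ ℂ :=
      fun n => ContinuousMultilinearMap.mkPiRing ℂ (Fin n) (p n) with hq
    have hrad : (1 : ENNReal) ≤ q.radius := by
      have : Summable fun n => ‖q n‖ * ((1 : NNReal) : ℝ) ^ n := by
        have := (hsum 1 (by simp)).summable.norm
        simpa [hq] using this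
      simpa using q.le_radius_of_summable_norm this
    have hfp : HasFPowerSeriesOnBall (0 : ℂ → ℂ) q 0 1 := by
      refine ⟨hrad, by simp, fun {y} hy => ?_⟩
      have hy' : ‖y‖ ≤ 1 := by
        have h1 : ‖y‖ₑ < 1 := by simpa using hy
        rw [← ofReal_norm, ENNReal.ofReal_lt_one] at h1
        exact h1.le
      simpa [hq] using hsum y hy'
    have := congrFun hfp.hasFPowerSeriesAt.eq_zero n
    have h2 := congrArg (fun m : ContinuousMultilinearMap ℂ (fun _ : Fin n => ℂ) ℂ =>
      m fun _ => 1) this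
    simpa [hq] using h2
  -- a polynomial that vanishes near the origin is zero
  have hnhds : (WithLp.toLp 2 : (Fin d → ℂ) → EuclideanSpace ℂ (Fin d)) ⁻¹' Metric.ball 0 1 ∈
      nhds (0 : Fin d → ℂ) := by
    refine (PiLp.continuous_toLp 2 _).continuousAt.preimage_mem_nhds ?_
    exact Metric.ball_mem_nhds _ one_pos
  obtain ⟨ε, hε, hball⟩ := Metric.mem_nhds_iff.1 hnhds
  funext α
  set n := ∑ i, α i with hn
  let P : MvPolynomial (Fin d) ℂ := ∑ β ∈ Finset.piAntidiag Finset.univ n,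
    MvPolynomial.monomial (Finsupp.equivFunOnFinite.symm β) (c β)
  have hP : P = 0 := by
    refine MvPolynomial.funext_set (fun _ => Metric.ball (0 : ℂ) ε)
      (fun _ => infinite_of_mem_nhds 0 (Metric.ball_mem_nhds _ hε)) fun x hx => ?_
    have hx' : x ∈ Metric.ball (0 : Fin d → ℂ) ε := by
      rw [ball_pi _ hε]; exact hx
    have := key n ⟨WithLp.toLp 2 x, hball hx'⟩
    simp only [P, map_sum, map_zero, MvPolynomial.eval_monomial]
    rw [← this]
    refine Finset.sum_congr rfl fun β _ => ?_
    rw [Finsupp.prod_fintype _ _ (by simp)]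
    simp [zpowMulti, mul_comm]
  have hc := congrArg (MvPolynomial.coeff (Finsupp.equivFunOnFinite.symm α)) hP
  simp only [P, MvPolynomial.coeff_sum, MvPolynomial.coeff_monomial,
    EmbeddingLike.apply_eq_iff_eq, MvPolynomial.coeff_zero] at hc
  rw [Finset.sum_ite_eq' ] at hc
  simpa [hn] using hc

section Model

variable {d : ℕ} {K : Type*} [NormedAddCommGroup K] [InnerProductSpace ℂ K] [CompleteSpace K]
  (S : Fin d → K →L[ℂ] K)

/-- The joint cokernel `E = ⋂_j ker S_j^*`. -/
def jointCokernel : Submodule ℂ K := ⨅ j, LinearMap.ker (ContinuousLinearMap.adjoint (S j)).toLinearMap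

/-- `S^α = S_1^{α_1} ⋯ S_d^{α_d}`. -/
def tuplePow (α : Fin d → ℕ) : K →L[ℂ] K := (List.ofFn fun j => S j ^ α j).prod

/-- `F(z) = ∑_α f_α z^α` on the unit ball and `∑_α ‖S^α f_α‖^2 < ∞`. -/
def IsExpansion (F : CBall d → jointCokernel S) (f : (Fin d → ℕ) → jointCokernel S) : Prop :=
  (∀ z : CBall d, HasSum (fun α => zpowMulti z.1 α • f α) (F z)) ∧
    Summable fun α => ‖tuplePow S α (f α : K)‖ ^ 2

variable {S}

theorem IsExpansion.unique {F : CBall d → jointCokernel S} {f g : (Fin d → ℕ) → jointCokernel S}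
    (hf : IsExpansion S F f) (hg : IsExpansion S F g) : f = g := by
  funext α
  refine ext_inner_left ℂ fun e => ?_
  rw [← sub_eq_zero, ← inner_sub_right]
  refine congrFun (scalar_coeff_eq_zero (fun α => inner ℂ e (f α - g α)) fun z => ?_) α
  have h := ((hf.1 z).sub (hg.1 z)).mapL (innerSL ℂ e)
  simpa [inner_smul_right, inner_sub_right, mul_sub] using h

set_option linter.unusedSectionVars false in
theorem summable_norm_sq_add {ι : Type*} {x y : ι → K} (hx : Summable fun i => ‖x i‖ ^ 2)
    (hy : Summable fun i => ‖y i‖ ^ 2) : Summable fun i => ‖x i + y i‖ ^ 2 := by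
  refine Summable.of_nonneg_of_le (fun _ => by positivity) (fun i => ?_)
    ((hx.mul_left 2).add (hy.mul_left 2))
  have := norm_add_le (x i) (y i)
  nlinarith [sq_nonneg (‖x i‖ - ‖y i‖), norm_nonneg (x i + y i), norm_nonneg (x i),
    norm_nonneg (y i)]

set_option linter.unusedSectionVars false in
theorem summable_inner_of_sq {ι : Type*} {x y : ι → K} (hx : Summable fun i => ‖x i‖ ^ 2)
    (hy : Summable fun i => ‖y i‖ ^ 2) : Summable fun i => inner ℂ (x i) (y i) := by
  refine Summable.of_norm_bounded (hx.add hy) fun i => (norm_inner_le_norm _ _).trans ?_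
  nlinarith [sq_nonneg (‖x i‖ - ‖y i‖), sq_nonneg (‖x i‖ + ‖y i‖)]

theorem IsExpansion.add {F G : CBall d → jointCokernel S} {f g : (Fin d → ℕ) → jointCokernel S}
    (hf : IsExpansion S F f) (hg : IsExpansion S G g) : IsExpansion S (F + G) (f + g) :=
  ⟨fun z => by simpa using (hf.1 z).add (hg.1 z),
    by simpa using summable_norm_sq_add hf.2 hg.2⟩

theorem IsExpansion.smul {F : CBall d → jointCokernel S} {f : (Fin d → ℕ) → jointCokernel S}
    (c : ℂ) (hf : IsExpansion S F f) : IsExpansion S (c • F) (c • f) :=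
  ⟨fun z => by simpa [smul_comm c] using (hf.1 z).const_smul c,
    by simpa [norm_smul, mul_pow] using hf.2.mul_left (‖c‖ ^ 2)⟩

theorem IsExpansion.zero : IsExpansion S 0 0 :=
  ⟨fun z => by simp, by simp⟩

variable (S)

/-- The `jointCokernel S`-valued functions `F(z) = ∑_α f_α z^α` on the unit ball with
`∑_α ‖S^α f_α‖^2 < ∞`. -/
def modelSubmodule : Submodule ℂ (CBall d → jointCokernel S) where
  carrier := {F | ∃ f, IsExpansion S F f}
  add_mem' := fun ⟨f, hf⟩ ⟨g, hg⟩ => ⟨f + g, hf.add hg⟩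
  zero_mem' := ⟨0, IsExpansion.zero⟩
  smul_mem' := fun c _ ⟨f, hf⟩ => ⟨c • f, hf.smul c⟩

/-- The model space of `S`: the space `modelSubmodule S` of vector-valued holomorphic functions on the
unit ball, with the inner product `⟨F, G⟩ = ∑_α ⟨S^α f_α, S^α g_α⟩`. The operators `S_j` become the
multiplications by the coordinates `z_j`, and `jointCokernel S` becomes the space of the constant
functions. -/
def AnalyticModel : Type _ := modelSubmodule S

namespace AnalyticModel

instance : AddCommGroup (AnalyticModel S) := inferInstanceAs (AddCommGroup (modelSubmodule S))

instance : Module ℂ (AnalyticModel S) := inferInstanceAs (Module ℂ (modelSubmodule S))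

variable {S}

/-- The function on the ball. -/
def toFun (F : AnalyticModel S) : CBall d → jointCokernel S := F.1

/-- The coefficients `f_α` of `F(z) = ∑_α f_α z^α`; they are unique. -/
def coeff (F : AnalyticModel S) : (Fin d → ℕ) → jointCokernel S := F.2.choose

theorem isExpansion_coeff (F : AnalyticModel S) : IsExpansion S F.toFun F.coeff :=
  F.2.choose_spec

theorem coeff_eq {F : AnalyticModel S} {f : (Fin d → ℕ) → jointCokernel S}
    (h : IsExpansion S F.toFun f) : F.coeff = f := F.isExpansion_coeff.unique h

theorem coeff_add (F G : AnalyticModel S) : (F + G).coeff = F.coeff + G.coeff :=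
  coeff_eq (F.isExpansion_coeff.add G.isExpansion_coeff)

theorem coeff_smul (c : ℂ) (F : AnalyticModel S) : (c • F).coeff = c • F.coeff :=
  coeff_eq (F.isExpansion_coeff.smul c)

instance instCore : PreInnerProductSpace.Core ℂ (AnalyticModel S) where
  inner F G := ∑' α, inner ℂ (tuplePow S α (F.coeff α : K)) (tuplePow S α (G.coeff α : K))
  conj_inner_symm F G := by
    rw [Complex.conj_tsum]
    simp [inner_conj_symm]
  re_inner_nonneg F := by
    have h : (∑' α, inner ℂ (tuplePow S α (F.coeff α : K)) (tuplePow S α (F.coeff α : K)))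
        = ((∑' α, ‖tuplePow S α (F.coeff α : K)‖ ^ 2 : ℝ) : ℂ) := by
      rw [Complex.ofReal_tsum]
      simp [inner_self_eq_norm_sq_to_K]
    rw [h]
    exact tsum_nonneg fun _ => by positivity
  add_left F G H := by
    rw [← Summable.tsum_add]
    · refine tsum_congr fun α => ?_
      have h : tuplePow S α ((F + G).coeff α : K)
          = tuplePow S α (F.coeff α : K) + tuplePow S α (G.coeff α : K) := by
        rw [coeff_add]; simp
      rw [h, inner_add_left]
    · exact summable_inner_of_sq F.isExpansion_coeff.2 H.isExpansion_coeff.2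
    · exact summable_inner_of_sq G.isExpansion_coeff.2 H.isExpansion_coeff.2
  smul_left F G c := by
    rw [← tsum_mul_left]
    refine tsum_congr fun α => ?_
    have h : tuplePow S α ((c • F).coeff α : K) = c • tuplePow S α (F.coeff α : K) := by
      rw [coeff_smul]; simp
    rw [h, inner_smul_left]

/-- The norm `‖F‖^2 = ∑_α ‖S^α f_α‖^2`. (It is positive definite if the operators `S_j` are
injective, as for the multishifts with positive weights on leafless trees.) -/
instance : SeminormedAddCommGroup (AnalyticModel S) :=
  InnerProductSpace.Core.toSeminormedAddCommGroup (𝕜 := ℂ)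

instance : InnerProductSpace ℂ (AnalyticModel S) := InnerProductSpace.ofCore instCore

/-- The element `z^α f` of the model space, where `f` is a constant function. -/
def monomial (α : Fin d → ℕ) (f : jointCokernel S) : AnalyticModel S :=
  ⟨fun z => zpowMulti z.1 α • f, by
    classical
    refine ⟨Pi.single α f, fun z => ?_, ?_⟩
    · have := hasSum_single (f := fun β => zpowMulti z.1 β • (Pi.single α f : _ → jointCokernel S) β)
        α fun β hβ => by simp [hβ]
      simpa using this
    · refine summable_of_ne_finset_zero (s := {α}) fun β hβ => ?_
      have : β ≠ α := by simpa using hβ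
      simp [this]⟩

end AnalyticModel

/-! ### Representing measures -/

/-- The scalar measure `A ↦ ⟨μ(A) f, f⟩` of an operator-valued measure whose values are positive
operators. -/
def scalarMeasure {X : Type*} [MeasurableSpace X] {H : Type*} [NormedAddCommGroup H]
    [InnerProductSpace ℂ H] (μ : VectorMeasure X (H →L[ℂ] H)) (f : H) : SignedMeasure X :=
  μ.mapRange
    { toFun := fun A => (inner ℂ f (A f)).re
      map_zero' := by simp
      map_add' := fun A B => by simp }
    (Complex.continuous_re.comp (continuous_const.inner (by fun_prop)))

end Model

/-- The operator-valued measure `μ` is a representing measure, supported on `[0, b] × ∂𝔹^d`, of the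
analytic model of the multishift with weights `lam`, with the diagonal entries `ρ_u × ν_u`,
`u ∈ Ω_F`, `F ⊆ {1, …, d}`. -/
structure IsRepresentingMeasure {d : ℕ} {V : Fin d → Type*} (T : ∀ j, RootedDirectedTree (V j))
    (lam : Fin d → (∀ i, V i) → ℝ) (Om : Finset (Fin d) → Set (∀ i, V i)) (b : ℝ)
    (μ : VectorMeasure (ℝ × CSphere d)
      (jointCokernel (TreeProduct.multishift T lam) →L[ℂ] jointCokernel (TreeProduct.multishift T lam)))
    (ρ : (∀ i, V i) → Measure ℝ) (ν : (∀ i, V i) → Measure (CSphere d)) : Prop where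
  b_pos : 0 < b
  supported : ∀ A, MeasurableSet A → Disjoint A (Set.Icc 0 b ×ˢ Set.univ) → μ A = 0
  isPositive : ∀ A, (μ A).IsPositive
  finite_rho : ∀ F, ∀ u ∈ Om F, IsFiniteMeasure (ρ u)
  finite_nu : ∀ F, ∀ u ∈ Om F, IsFiniteMeasure (ν u)
  /-- Integral representation. -/
  integral_repr : ∀ (f : jointCokernel (TreeProduct.multishift T lam)) (α : Fin d → ℕ),
    (scalarMeasure μ f).Integrable
        (fun p : ℝ × CSphere d => p.1 ^ (∑ i, α i) * ‖zpowMulti p.2.1 α‖ ^ 2) ∧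
      ‖AnalyticModel.monomial α f‖ ^ 2 =
        ∫ᵛ p, p.1 ^ (∑ i, α i) * ‖zpowMulti p.2.1 α‖ ^ 2 ∂•(scalarMeasure μ f)
  /-- Diagonal measure: `(ρ × ν)(A) (∑ g_{u,F}) = ∑ (ρ_u × ν_u)(A) g_{u,F}` for `g_{u,F} ∈ L_{u,F}`,
  the sums being taken over all `F` and all `u ∈ Ω_F`. -/
  diagonal : ∀ A, MeasurableSet A →
    ∀ (g : (F : Finset (Fin d)) → Om F → jointCokernel (TreeProduct.multishift T lam))
      (f : jointCokernel (TreeProduct.multishift T lam)),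
    (∀ F u, (g F u : SqSum (∀ i, V i)) ∈ TreeProduct.solutionSpace T lam F u.1) →
    HasSum (fun p : (F : Finset (Fin d)) × Om F => g p.1 p.2) f →
    HasSum (fun p : (F : Finset (Fin d)) × Om F =>
      (((ρ p.2.1).prod (ν p.2.1)).real A : ℂ) • g p.1 p.2) (μ A f)
  /-- Normalization. -/
  prob_rho : IsProbabilityMeasure (ρ (TreeProduct.root T))
  prob_nu : IsProbabilityMeasure (ν (TreeProduct.root T))

/-! ### The explicit measures -/

/-- The normalized surface area measure on the unit sphere of `ℂ^d`. -/
def sphereMeasure (d : ℕ) : Measure (CSphere d) :=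
  ((volume : Measure (EuclideanSpace ℂ (Fin d))).toSphere Set.univ)⁻¹ •
    (volume : Measure (EuclideanSpace ℂ (Fin d))).toSphere

/-- `ω_l(s) = (l + a) ⋯ (l + d - 1) ∑_{i = a}^{d - 1} s^{i + l - 1} / ∏_{a ≤ j ≠ i ≤ d - 1} (j - i)`. -/
def omegaWeight (a d l : ℕ) (s : ℝ) : ℝ :=
  (∏ i ∈ Finset.Ico a d, ((l : ℝ) + i)) *
    ∑ i ∈ Finset.Ico a d, s ^ (i + l - 1) / ∏ j ∈ (Finset.Ico a d).erase i, ((j : ℝ) - i)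

/-- `ω_l(s) ds` on `[0, 1]`. -/
def radialMeasure (a d l : ℕ) : Measure ℝ :=
  (volume.restrict (Set.Icc (0 : ℝ) 1)).withDensity fun s => ENNReal.ofReal (omegaWeight a d l s)

/-- `|z^β|^2 / ‖z^β‖^2 dσ(z)`, with the norm of `L^2(∂𝔹^d, σ)`. -/
def sphericalMeasure (d : ℕ) (β : Fin d → ℕ) : Measure (CSphere d) :=
  (sphereMeasure d).withDensity fun z =>
    ENNReal.ofReal (‖zpowMulti z.1 β‖ ^ 2 / ∫ w, ‖zpowMulti w.1 β‖ ^ 2 ∂(sphereMeasure d))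

end

/-! For `w ∈ Chi_j(v)` the squared weight of the Cauchy dual `S` is a number depending only on `j`
and the depth of `v`, divided by `card Chi_j(v)`. Distinct vertices have disjoint sets of
`j`-children, so `‖S_j f‖²` depends only on how the mass of `f` is distributed over the depths.
Iterating, `‖S^α f‖² = ∑_β ‖P_β f‖² M(α, β)`, where `P_β` projects onto the functions supported at
depth `β` and `M` is an explicit product (`dualMoment`, `hasDualMoment_tuplePow`).

Since `S_j` raises the depth by exactly one step in direction `j`, each `P_β` preserves the joint
cokernel `E`. Beyond the branching index a vertex is an only child, and `S_j^* f = 0` forces `f` to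
vanish there. Hence finitely many `P_β`, `β ≤ N`, sum to the identity on `E`, and `μ = ∑_{β ≤ N}
(ρ_β × ν_β) P_β` is a positive operator measure. It acts on `L_{u,F}` as the scalar `ρ_u × ν_u`
because `sib_F(u)` lies at the single depth `d_u`.

What remains is that the moments of `ρ_β × ν_β` are `M(α, β)` (`integral_prod_radial_spherical`).
The spherical factor is a ratio of `L²` norms of monomials, found by computing one Gaussian integral
in Cartesian and in polar coordinates. The radial factor comes from partial fractions and
telescopes. Nonnegativity of `ω_l` holds because its sum is the binomial expansion of `s^(a+l-1)
(1-s)^(d-1-a) / (d-1-a)!`. -/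

/-! ### Moments of monomials on the sphere -/

theorem integral_radial_mul_sphere {E : Type*} [NormedAddCommGroup E] [NormedSpace ℝ E]
    [FiniteDimensional ℝ E] [MeasurableSpace E] [BorelSpace E] [Nontrivial E]
    (μ : Measure E) [μ.IsAddHaarMeasure] (F : E → ℝ) (f : Metric.sphere (0 : E) 1 → ℝ) (g : ℝ → ℝ)
    (h : ∀ (u : Metric.sphere (0 : E) 1) (r : ℝ), 0 < r → F (r • u.1) = f u * g r) :
    ∫ x, F x ∂μ = (∫ u, f u ∂μ.toSphere) *
      ∫ r in Set.Ioi (0 : ℝ), r ^ (Module.finrank ℝ E - 1) * g r := by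
  calc
    ∫ x, F x ∂μ = ∫ x : ({(0)}ᶜ : Set E), F x.1 ∂(μ.comap (↑)) := by
      rw [integral_subtype_comap (measurableSet_singleton _).compl F, restrict_compl_singleton]
    _ = ∫ x : Metric.sphere (0 : E) 1 × Set.Ioi (0 : ℝ), f x.1 * g x.2.1
          ∂μ.toSphere.prod (.volumeIoiPow (Module.finrank ℝ E - 1)) := by
      rw [← μ.measurePreserving_homeomorphUnitSphereProd.integral_comp
        (Homeomorph.measurableEmbedding _)]
      refine integral_congr_ae (.of_forall fun x => ?_)
      dsimp only
      rw [← h _ _ (homeomorphUnitSphereProd E x).2.2]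
      congr 1
      have hx : ‖x.1‖ ≠ 0 := norm_ne_zero_iff.2 x.2
      simp [smul_smul, hx]
    -- The integral of a product function factors without any integrability assumption, so none is
    -- needed here.
    _ = (∫ u, f u ∂μ.toSphere) *
        ∫ x : Set.Ioi (0 : ℝ), g x ∂.volumeIoiPow (Module.finrank ℝ E - 1) :=
      integral_prod_mul (L := ℝ) f fun x : Set.Ioi (0 : ℝ) => g x
    _ = _ := by
      simp only [Measure.volumeIoiPow, ENNReal.ofReal]
      rw [integral_withDensity_eq_integral_smul,
        integral_subtype_comap measurableSet_Ioi
          fun a ↦ Real.toNNReal (a ^ (Module.finrank ℝ E - 1)) • g a,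
        setIntegral_congr_fun measurableSet_Ioi fun x hx ↦ ?_]
      · rw [NNReal.smul_def, Real.coe_toNNReal _ (pow_nonneg (Set.mem_Ioi.1 hx).le _)]; rfl
      · exact (measurable_subtype_coe.pow_const _).real_toNNReal

theorem zpowMulti_smul {d : ℕ} (r : ℝ) (z : EuclideanSpace ℂ (Fin d)) (β : Fin d → ℕ) :
    zpowMulti (r • z) β = (r : ℂ) ^ (∑ i, β i) * zpowMulti z β := by
  simp [zpowMulti, mul_pow, Finset.prod_mul_distrib, Finset.prod_pow_eq_pow_sum]

theorem integral_pow_mul_exp_neg_sq (n : ℕ) :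
    ∫ r in Set.Ioi (0 : ℝ), r ^ (2 * n + 1) * Real.exp (-r ^ 2) = n.factorial / 2 := by
  have h := integral_rpow_mul_exp_neg_rpow (p := 2) (q := ((2 * n + 1 : ℕ) : ℝ)) (by norm_num)
    (lt_of_lt_of_le (by norm_num : (-1 : ℝ) < 0) (Nat.cast_nonneg _))
  have e : (((2 * n + 1 : ℕ) : ℝ) + 1) / 2 = n + 1 := by push_cast; ring
  rw [e, Real.Gamma_nat_eq_factorial] at h
  simp only [Real.rpow_natCast, Real.rpow_two] at h
  rw [h]; ring

theorem integral_complex_pow_mul_exp_neg_sq (n : ℕ) :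
    ∫ z : ℂ, ‖z‖ ^ (2 * n) * Real.exp (-‖z‖ ^ 2) = Real.pi * n.factorial := by
  have h := Complex.integral_rpow_mul_exp_neg_rpow (p := 2) (q := ((2 * n : ℕ) : ℝ)) (by norm_num)
    (lt_of_lt_of_le (by norm_num : (-2 : ℝ) < 0) (Nat.cast_nonneg _))
  have e : (((2 * n : ℕ) : ℝ) + 2) / 2 = n + 1 := by push_cast; ring
  rw [e, Real.Gamma_nat_eq_factorial] at h
  simp only [Real.rpow_natCast, Real.rpow_two] at h
  rw [h]; ring

/-- Uniqueness of Haar measure. The constant is left unspecified: only ratios of sphere moments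
matter, and it cancels. -/
theorem exists_integral_euclidean_eq (d : ℕ) : ∃ c : ℝ, c ≠ 0 ∧ ∀ f : (Fin d → ℂ) → ℝ,
    ∫ z : EuclideanSpace ℂ (Fin d), f (WithLp.ofLp z) = c * ∫ x, f x := by
  let e : EuclideanSpace ℂ (Fin d) ≃L[ℝ] (Fin d → ℂ) := PiLp.continuousLinearEquiv 2 ℝ _
  set μ := (volume : Measure (EuclideanSpace ℂ (Fin d))).map e with hμ
  have : μ.IsAddHaarMeasure := e.isAddHaarMeasure_map volume
  refine ⟨μ.addHaarScalarFactor volume, ?_, fun f => ?_⟩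
  · exact_mod_cast (Measure.addHaarScalarFactor_pos_of_isAddHaarMeasure μ volume).ne'
  · have h1 := e.toHomeomorph.measurableEmbedding.integral_map (μ := volume) f
    have h2 : ∫ z : EuclideanSpace ℂ (Fin d), f (WithLp.ofLp z) = ∫ x, f x ∂μ := h1.symm
    have h3 := congrArg (fun m => ∫ x, f x ∂m) (Measure.isAddLeftInvariant_eq_smul μ volume)
    rw [h2, h3, integral_smul_nnreal_measure]
    rfl

theorem sum_norm_sq_eq {d : ℕ} (z : EuclideanSpace ℂ (Fin d)) : ∑ i, ‖z i‖ ^ 2 = ‖z‖ ^ 2 := by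
  rw [EuclideanSpace.norm_sq_eq]

/-- The Gaussian integral splits into one integral over `ℂ` per coordinate; `c` does not depend on
`β`. -/
theorem integral_zpowMulti_mul_exp (d : ℕ) : ∃ c : ℝ, c ≠ 0 ∧ ∀ β : Fin d → ℕ,
    ∫ z : EuclideanSpace ℂ (Fin d), ‖zpowMulti z β‖ ^ 2 * Real.exp (-‖z‖ ^ 2) =
      c * ∏ i, ((β i).factorial : ℝ) := by
  obtain ⟨c, hc, h⟩ := exists_integral_euclidean_eq d
  refine ⟨c * Real.pi ^ d, by positivity, fun β => ?_⟩
  have h1 := h fun x => ∏ i, (‖x i‖ ^ (2 * β i) * Real.exp (-‖x i‖ ^ 2))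
  rw [integral_fintype_prod_volume_eq_prod
    (f := fun i (z : ℂ) => ‖z‖ ^ (2 * β i) * Real.exp (-‖z‖ ^ 2))] at h1
  simp only [integral_complex_pow_mul_exp_neg_sq, Finset.prod_mul_distrib, Finset.prod_const,
    Finset.card_univ, Fintype.card_fin, ← Real.exp_sum, Finset.sum_neg_distrib,
    sum_norm_sq_eq] at h1
  rw [mul_assoc, ← h1]
  simp only [zpowMulti, norm_prod, norm_pow, ← Finset.prod_pow, ← pow_mul, mul_comm]

/-- `‖z^β‖^2` in `L^2(∂𝔹^d, σ)`. -/
noncomputable def sphereMoment (d : ℕ) (β : Fin d → ℕ) : ℝ := ∫ w, ‖zpowMulti w.1 β‖ ^ 2 ∂(sphereMeasure d)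

/-- The same Gaussian integral in polar coordinates is the sphere moment times a radial integral,
which equals `(d - 1 + |β|)! / 2`. -/
theorem exists_sphereMoment_mul_factorial {d : ℕ} (hd : 0 < d) : ∃ C : ℝ, C ≠ 0 ∧
    ∀ β : Fin d → ℕ, sphereMoment d β * ((d - 1 + ∑ i, β i).factorial : ℝ) =
      C * ∏ i, ((β i).factorial : ℝ) := by
  have : Nonempty (Fin d) := ⟨⟨0, hd⟩⟩
  obtain ⟨c, hc, h⟩ := integral_zpowMulti_mul_exp d
  set μ := (volume : Measure (EuclideanSpace ℂ (Fin d))) with hμ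
  have hs : (μ.toSphere Set.univ)⁻¹.toReal ≠ 0 := by
    refine ENNReal.toReal_ne_zero.2 ⟨ENNReal.inv_ne_zero.2 (measure_ne_top _ _), ?_⟩
    rw [ENNReal.inv_ne_top]
    exact Measure.measure_univ_ne_zero.2 μ.toSphere_ne_zero
  refine ⟨(μ.toSphere Set.univ)⁻¹.toReal * (c * 2), by positivity, fun β => ?_⟩
  have hr : Module.finrank ℝ (EuclideanSpace ℂ (Fin d)) = 2 * d := by
    rw [(PiLp.continuousLinearEquiv 2 ℝ fun _ : Fin d => ℂ).toLinearEquiv.finrank_eq]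
    simp [Module.finrank_pi_fintype, mul_comm]
  have h1 := integral_radial_mul_sphere μ
    (fun z => ‖zpowMulti z β‖ ^ 2 * Real.exp (-‖z‖ ^ 2)) (fun u => ‖zpowMulti u.1 β‖ ^ 2)
    (fun r => r ^ (2 * ∑ i, β i) * Real.exp (-r ^ 2)) fun u r hr => by
      have hu : ‖u.1‖ = 1 := by simp
      simp only [zpowMulti_smul, norm_mul, norm_pow, norm_smul, hu, Complex.norm_real,
        Real.norm_eq_abs, mul_one, abs_of_pos hr]
      ring
  have h2 : ∀ r : ℝ, r ^ (2 * d - 1) * (r ^ (2 * ∑ i, β i) * Real.exp (-r ^ 2)) =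
      r ^ (2 * (d - 1 + ∑ i, β i) + 1) * Real.exp (-r ^ 2) := fun r => by
    rw [← mul_assoc, ← pow_add]
    congr 2
    omega
  rw [h, hr] at h1
  simp only [h2, integral_pow_mul_exp_neg_sq] at h1
  rw [sphereMoment, sphereMeasure, integral_smul_measure, smul_eq_mul]
  rw [mul_assoc, mul_assoc, mul_right_comm, h1]
  ring

theorem prod_range_natCast_add_mul_factorial (m k : ℕ) :
    (∏ t ∈ Finset.range k, ((m : ℝ) + 1 + t)) * m.factorial = (m + k).factorial := by
  induction k with
  | zero => simp
  | succ k ih =>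
    rw [Finset.prod_range_succ, mul_right_comm, ih, ← add_assoc, Nat.factorial_succ]
    push_cast
    ring

theorem sphereMoment_ne_zero {d : ℕ} (hd : 0 < d) (β : Fin d → ℕ) : sphereMoment d β ≠ 0 := by
  obtain ⟨C, hC, h⟩ := exists_sphereMoment_mul_factorial hd
  intro h0
  have := h β
  rw [h0, zero_mul] at this
  have h2 : (∏ i, ((β i).factorial : ℝ)) ≠ 0 :=
    Finset.prod_ne_zero_iff.2 fun i _ => by exact_mod_cast (β i).factorial_ne_zero
  exact mul_ne_zero hC h2 this.symm

theorem sphereMoment_add {d : ℕ} (hd : 0 < d) (α β : Fin d → ℕ) :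
    sphereMoment d (α + β) * ∏ t ∈ Finset.range (∑ i, α i), (((∑ i, β i : ℕ) : ℝ) + d + t) =
      sphereMoment d β * ∏ i, ∏ t ∈ Finset.range (α i), ((β i : ℝ) + 1 + t) := by
  obtain ⟨C, hC, h⟩ := exists_sphereMoment_mul_factorial hd
  have h1 := prod_range_natCast_add_mul_factorial (d - 1 + ∑ i, β i) (∑ i, α i)
  have h2 : ∀ t : ℕ, ((d - 1 + ∑ i, β i : ℕ) : ℝ) + 1 + t = ((∑ i, β i : ℕ) : ℝ) + d + t := by
    intro t
    push_cast [Nat.cast_sub (Nat.one_le_of_lt hd)]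
    ring
  simp only [h2] at h1
  have h3 : (d - 1 + ∑ i, β i) + ∑ i, α i = d - 1 + ∑ i, (α + β) i := by
    simp [Finset.sum_add_distrib]; ring
  have h4 := h (α + β)
  rw [← h3, ← h1] at h4
  have h5 : ∏ i, (((α + β) i).factorial : ℝ) =
      (∏ i, ∏ t ∈ Finset.range (α i), ((β i : ℝ) + 1 + t)) * ∏ i, ((β i).factorial : ℝ) := by
    rw [← Finset.prod_mul_distrib]
    refine Finset.prod_congr rfl fun i _ => ?_
    rw [prod_range_natCast_add_mul_factorial, Pi.add_apply, add_comm]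
  have h6 : ((d - 1 + ∑ i, β i).factorial : ℝ) ≠ 0 := by exact_mod_cast Nat.factorial_ne_zero _
  apply mul_right_cancel₀ h6
  rw [h5] at h4
  linear_combination h4 - (∏ i, ∏ t ∈ Finset.range (α i), ((β i : ℝ) + 1 + t)) * h β

/-! ### The radial density and its moments -/

theorem prod_Ico_erase_sub {a d i : ℕ} (hai : a ≤ i) (hid : i < d) :
    ∏ j ∈ (Finset.Ico a d).erase i, ((j : ℝ) - i) =
      (-1) ^ (i - a) * (i - a).factorial * (d - 1 - i).factorial := by
  have hsplit : (Finset.Ico a d).erase i = Finset.Ico a i ∪ Finset.Ico (i + 1) d := by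
    ext j; simp; omega
  have hdisj : Disjoint (Finset.Ico a i) (Finset.Ico (i + 1) d) := by
    rw [Finset.disjoint_left]; intro j; simp; omega
  rw [hsplit, Finset.prod_union hdisj]
  congr 1
  · rw [← Finset.prod_range_add_one_eq_factorial, Nat.cast_prod, Finset.prod_Ico_eq_prod_range,
      ← Finset.prod_range_reflect]
    have h1 : (-1 : ℝ) ^ (i - a) = ∏ _t ∈ Finset.range (i - a), (-1 : ℝ) := by simp
    rw [h1, ← Finset.prod_mul_distrib]
    refine Finset.prod_congr rfl fun t ht => ?_
    have : t < i - a := Finset.mem_range.1 ht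
    have h : ((a + (i - a - 1 - t) : ℕ) : ℝ) + (t + 1) = i := by
      norm_cast; omega
    push_cast at h ⊢
    linarith
  · rw [← Finset.prod_range_add_one_eq_factorial, Nat.cast_prod, Finset.prod_Ico_eq_prod_range]
    have e : d - (i + 1) = d - 1 - i := by omega
    rw [e]
    refine Finset.prod_congr rfl fun t ht => ?_
    push_cast
    ring

/-- By `prod_Ico_erase_sub` the denominators are signed products of two factorials, so the sum is
the binomial expansion of `(1 - s)^(d-1-a)`. In this form the sign on `[0, 1]` is visible. -/
theorem omegaWeight_eq {a d : ℕ} (ha : 0 < a) (had : a < d) (l : ℕ) (s : ℝ) :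
    omegaWeight a d l s = (∏ i ∈ Finset.Ico a d, ((l : ℝ) + i)) *
      (s ^ (a + l - 1) * (1 - s) ^ (d - 1 - a) / (d - 1 - a).factorial) := by
  rw [omegaWeight]
  congr 1
  set n := d - 1 - a with hn
  have hd : d - a = n + 1 := by omega
  rw [Finset.sum_Ico_eq_sum_range, hd, ← neg_add_eq_sub s 1, add_pow, Finset.mul_sum,
    Finset.sum_div]
  refine Finset.sum_congr rfl fun m hm => ?_
  have hm' : m ≤ n := Nat.lt_succ_iff.1 (Finset.mem_range.1 hm)
  rw [prod_Ico_erase_sub (by omega) (by omega)]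
  have e1 : a + m + l - 1 = (a + l - 1) + m := by omega
  have e2 : d - 1 - (a + m) = n - m := by omega
  have e3 : a + m - a = m := by omega
  have h := Nat.choose_mul_factorial_mul_factorial hm'
  have h' : (n.choose m : ℝ) * m.factorial * (n - m).factorial = n.factorial := by
    exact_mod_cast h
  have hsq : ((-1 : ℝ) ^ m) * (-1) ^ m = 1 := by rw [← mul_pow]; simp
  rw [e1, e2, e3, neg_pow s m, one_pow, mul_one, pow_add,
    div_eq_div_iff (by positivity) (by positivity), ← h']
  linear_combination (-(s ^ (a + l - 1) * s ^ m * n.choose m * m.factorial * (n - m).factorial)) * hsq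

theorem omegaWeight_nonneg {a d : ℕ} (ha : 0 < a) (had : a < d) (l : ℕ) {s : ℝ}
    (hs : s ∈ Set.Icc (0 : ℝ) 1) : 0 ≤ omegaWeight a d l s := by
  rw [omegaWeight_eq ha had]
  have h0 := hs.1
  have h1 : 0 ≤ 1 - s := sub_nonneg.2 hs.2
  positivity

/-- Partial fractions with simple poles at the points `-i`, read off from Lagrange interpolation of
the constant `1` at these nodes. -/
theorem sum_inv_mul_prod_sub {a d : ℕ} (had : a < d) {x : ℝ} (hx : ∀ i ∈ Finset.Ico a d, x + i ≠ 0) :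
    ∑ i ∈ Finset.Ico a d, (x + i)⁻¹ / ∏ j ∈ (Finset.Ico a d).erase i, ((j : ℝ) - i) =
      (∏ i ∈ Finset.Ico a d, (x + i))⁻¹ := by
  have hinj : Set.InjOn (fun i : ℕ => -(i : ℝ)) (Finset.Ico a d) := fun i _ j _ h => by
    simpa using h
  have h := Lagrange.eval_interpolate_not_at_node (s := Finset.Ico a d)
    (v := fun i : ℕ => -(i : ℝ)) (fun _ => 1) (x := x) fun i hi h => hx i hi (by rw [h]; ring)
  have h1 : Lagrange.interpolate (Finset.Ico a d) (fun i : ℕ => -(i : ℝ)) (fun _ => (1 : ℝ)) = 1 :=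
    Lagrange.interpolate_one hinj ⟨a, by simpa using had⟩
  rw [h1, Polynomial.eval_one, Lagrange.eval_nodal] at h
  simp only [sub_neg_eq_add, mul_one] at h
  refine Eq.trans (Finset.sum_congr rfl fun i _ => ?_) (eq_inv_of_mul_eq_one_right h.symm)
  rw [Lagrange.nodalWeight, Finset.prod_inv_distrib, div_eq_inv_mul]
  simp only [neg_sub_neg]

theorem continuous_omegaWeight (a d l : ℕ) : Continuous (omegaWeight a d l) := by
  unfold omegaWeight
  fun_prop

theorem integral_pow_radialMeasure {a d : ℕ} (ha : 0 < a) (had : a < d) (l k : ℕ) :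
    ∫ s, s ^ k ∂(radialMeasure a d l) =
      ∏ i ∈ Finset.Ico a d, ((l : ℝ) + i) / ((l : ℝ) + k + i) := by
  rw [radialMeasure, integral_withDensity_eq_integral_toReal_smul
    (by have := continuous_omegaWeight a d l; fun_prop) (by simp)]
  have h1 : ∫ s in Set.Icc (0 : ℝ) 1, (ENNReal.ofReal (omegaWeight a d l s)).toReal • s ^ k =
      ∫ s in (0 : ℝ)..1, omegaWeight a d l s * s ^ k := by
    rw [intervalIntegral.integral_of_le zero_le_one, ← integral_Icc_eq_integral_Ioc]
    refine setIntegral_congr_fun measurableSet_Icc fun s hs => ?_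
    simp only [ENNReal.toReal_ofReal (omegaWeight_nonneg ha had l hs), smul_eq_mul]
  have hx : ∀ i ∈ Finset.Ico a d, (l : ℝ) + k + i ≠ 0 := fun i hi => by
    have : 0 < i := ha.trans_le (Finset.mem_Ico.1 hi).1
    positivity
  rw [h1, Finset.prod_div_distrib, div_eq_mul_inv, ← sum_inv_mul_prod_sub had hx]
  simp only [omegaWeight, mul_assoc, Finset.sum_mul]
  rw [intervalIntegral.integral_const_mul, intervalIntegral.integral_finsetSum]
  · congr 1
    refine Finset.sum_congr rfl fun i hi => ?_
    have hi0 : 0 < i := ha.trans_le (Finset.mem_Ico.1 hi).1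
    simp only [div_mul_eq_mul_div, ← pow_add]
    rw [intervalIntegral.integral_div, integral_pow]
    congr 1
    have e : i + l - 1 + k + 1 = l + k + i := by omega
    have e' : ((i + l - 1 + k : ℕ) : ℝ) + 1 = (l : ℝ) + k + i := by exact_mod_cast e
    rw [e', e]
    simp [hi0.ne']
  · intro i _
    exact Continuous.intervalIntegrable (by fun_prop) _ _

/-- Raising `k` by one shifts the window of denominators, so all but the two end factors cancel. The
right-hand side has one factor for each application of a shift. -/
theorem prod_Ico_div_eq_prod_range {a d : ℕ} (ha : 0 < a) (had : a < d) (l k : ℕ) :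
    ∏ i ∈ Finset.Ico a d, ((l : ℝ) + i) / ((l : ℝ) + k + i) =
      ∏ t ∈ Finset.range k, ((l : ℝ) + t + a) / ((l : ℝ) + t + d) := by
  induction k with
  | zero =>
    simp only [Nat.cast_zero, add_zero, Finset.range_zero, Finset.prod_empty]
    refine Finset.prod_eq_one fun i hi => div_self ?_
    have : 0 < i := ha.trans_le (Finset.mem_Ico.1 hi).1
    positivity
  | succ k ih =>
    rw [Finset.prod_range_succ, ← ih, Finset.prod_div_distrib, Finset.prod_div_distrib]
    -- The product over `a ≤ i ≤ d` is split off once at its top and once at its bottom.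
    have h1 := Finset.prod_Ico_succ_top had.le fun i => (l : ℝ) + k + i
    have h2 := Finset.prod_eq_prod_Ico_succ_bot (had.trans (Nat.lt_succ_self d))
      fun i : ℕ => (l : ℝ) + k + i
    have h3 := Finset.prod_Ico_add' (fun i : ℕ => (l : ℝ) + k + i) a d 1
    rw [h1, ← h3] at h2
    have e : ∏ i ∈ Finset.Ico a d, ((l : ℝ) + ((k + 1 : ℕ) : ℝ) + i) =
        ∏ i ∈ Finset.Ico a d, ((l : ℝ) + k + ((i + 1 : ℕ) : ℝ)) :=
      Finset.prod_congr rfl fun i _ => by push_cast; ring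
    have hpos : ∀ m : ℕ, 0 < ∏ i ∈ Finset.Ico a d, ((l : ℝ) + m + i) := fun m =>
      Finset.prod_pos fun i hi => by
        have : 0 < i := ha.trans_le (Finset.mem_Ico.1 hi).1
        positivity
    have p1 := hpos (k + 1)
    have p2 := hpos k
    have hd : 0 < (l : ℝ) + k + d := by have := ha.trans had; positivity
    rw [e] at p1 ⊢
    rw [div_mul_div_comm, div_eq_div_iff p1.ne' (by positivity)]
    linear_combination (∏ i ∈ Finset.Ico a d, ((l : ℝ) + i)) * h2

/-! ### The explicit measures and their joint moments -/

instance isFiniteMeasure_radialMeasure (a d l : ℕ) : IsFiniteMeasure (radialMeasure a d l) :=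
  isFiniteMeasure_withDensity_ofReal
    ((continuous_omegaWeight a d l).integrableOn_Icc).2

theorem isProbabilityMeasure_radialMeasure {a d : ℕ} (ha : 0 < a) (had : a < d) (l : ℕ) :
    IsProbabilityMeasure (radialMeasure a d l) := by
  have h := integral_pow_radialMeasure ha had l 0
  rw [prod_Ico_div_eq_prod_range ha had] at h
  simpa [isProbabilityMeasure_iff_real] using h

theorem radialMeasure_eq_zero (a d l : ℕ) {A : Set ℝ} (hA : Disjoint A (Set.Icc 0 1)) :
    radialMeasure a d l A = 0 := by
  refine withDensity_absolutelyContinuous _ _ ?_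
  rw [Measure.restrict_apply' measurableSet_Icc, hA.inter_eq, measure_empty]

instance isFiniteMeasure_sphereMeasure (d : ℕ) : IsFiniteMeasure (sphereMeasure d) := by
  constructor
  rw [sphereMeasure, Measure.smul_apply, smul_eq_mul]
  -- This bound also holds for total mass `0`, which covers `d = 0`.
  exact (ENNReal.inv_mul_le_one _).trans_lt ENNReal.one_lt_top

theorem norm_zpowMulti_le_one {d : ℕ} (z : CSphere d) (β : Fin d → ℕ) : ‖zpowMulti z.1 β‖ ≤ 1 := by
  rw [zpowMulti, norm_prod]
  refine Finset.prod_le_one (fun _ _ => norm_nonneg _) fun i _ => ?_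
  rw [norm_pow]
  refine pow_le_one₀ (norm_nonneg _) ((PiLp.norm_apply_le z.1 i).trans ?_)
  simp

theorem continuous_zpowMulti {d : ℕ} (β : Fin d → ℕ) :
    Continuous fun z : CSphere d => zpowMulti z.1 β := by
  unfold zpowMulti
  fun_prop

instance isFiniteMeasure_sphericalMeasure (d : ℕ) (β : Fin d → ℕ) :
    IsFiniteMeasure (sphericalMeasure d β) := by
  refine isFiniteMeasure_withDensity_ofReal (Integrable.div_const ?_ _).2
  exact Integrable.of_bound ((continuous_zpowMulti β).norm.pow 2).aestronglyMeasurable 1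
    (.of_forall fun z => by
      simpa using norm_zpowMulti_le_one z β)

theorem integral_zpowMulti_sphericalMeasure {d : ℕ} (α β : Fin d → ℕ) :
    ∫ z, ‖zpowMulti z.1 α‖ ^ 2 ∂(sphericalMeasure d β) =
      sphereMoment d (α + β) / sphereMoment d β := by
  have hc := (continuous_zpowMulti β).measurable
  rw [sphericalMeasure, integral_withDensity_eq_integral_toReal_smul (by fun_prop) (by simp),
    sphereMoment, ← integral_div]
  refine integral_congr_ae (.of_forall fun z => ?_)
  dsimp only
  rw [ENNReal.toReal_ofReal (by positivity), smul_eq_mul]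
  simp only [zpowMulti, Pi.add_apply, pow_add, Finset.prod_mul_distrib, norm_mul, mul_pow,
    sphereMoment]
  ring

/-- The factor `‖S^α e‖^2` of the spherical Cauchy dual `S`, for a unit vector `e` at depth `β`. -/
noncomputable def dualMoment (a : ℕ) {d : ℕ} (α β : Fin d → ℕ) : ℝ :=
  (∏ i, ∏ t ∈ Finset.range (α i), ((β i : ℝ) + 1 + t)) *
    ∏ t ∈ Finset.range (∑ i, α i), ((((∑ i, β i : ℕ) : ℝ) + t + a) /
      (((∑ i, β i : ℕ) : ℝ) + t + d) ^ 2)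

/-- The radial factor is `∏ (l + t + a) / (l + t + d)` with `l = |β|`. The spherical one contributes
`∏ (l + t + d)` to the denominator once more, whence the square in `dualMoment`. -/
theorem integral_prod_radial_spherical {a d : ℕ} (ha : 0 < a) (had : a < d) (α β : Fin d → ℕ) :
    ∫ p, p.1 ^ (∑ i, α i) * ‖zpowMulti p.2.1 α‖ ^ 2
        ∂((radialMeasure a d (∑ i, β i)).prod (sphericalMeasure d β)) = dualMoment a α β := by
  have hd := ha.trans had
  rw [integral_prod_mul (L := ℝ) (fun s : ℝ => s ^ (∑ i, α i))
    (fun z : CSphere d => ‖zpowMulti z.1 α‖ ^ 2), integral_pow_radialMeasure ha had,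
    prod_Ico_div_eq_prod_range ha had, integral_zpowMulti_sphericalMeasure, dualMoment]
  have h := sphereMoment_add hd α β
  have h0 := sphereMoment_ne_zero hd β
  have hp : ∏ t ∈ Finset.range (∑ i, α i), (((∑ i, β i : ℕ) : ℝ) + t + d) ≠ 0 :=
    Finset.prod_ne_zero_iff.2 fun t _ => by positivity
  simp only [add_right_comm _ (d : ℝ)] at h
  rw [Finset.prod_div_distrib, Finset.prod_div_distrib, Finset.prod_pow]
  field_simp
  linear_combination h

/-- A non-integrable function has Bochner integral `0`, whereas the integral was found to be
positive. -/
theorem integrable_prod_radial_spherical {a d : ℕ} (ha : 0 < a) (had : a < d) (α β : Fin d → ℕ) :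
    Integrable (fun p : ℝ × CSphere d => p.1 ^ (∑ i, α i) * ‖zpowMulti p.2.1 α‖ ^ 2)
      ((radialMeasure a d (∑ i, β i)).prod (sphericalMeasure d β)) := by
  by_contra h
  have h1 := integral_prod_radial_spherical ha had α β
  rw [integral_undef h] at h1
  refine absurd h1.symm (ne_of_gt ?_)
  rw [dualMoment]
  have := ha.trans had
  positivity

theorem isProbabilityMeasure_sphericalMeasure {d : ℕ} (hd : 0 < d) (β : Fin d → ℕ) :
    IsProbabilityMeasure (sphericalMeasure d β) := by
  have h := integral_zpowMulti_sphericalMeasure 0 β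
  rw [zero_add, div_self (sphereMoment_ne_zero hd β)] at h
  simpa [isProbabilityMeasure_iff_real, zpowMulti] using h

/-! ### Parents, generations and depth in a tree -/

namespace RootedDirectedTree

variable {V : Type*} (T : RootedDirectedTree V)

theorem ne_root_of_adj {v w : V} (h : T.Adj v w) : w ≠ T.root := fun e => T.not_adj_root v (e ▸ h)

theorem parent_adj {v : V} (h : v ≠ T.root) : T.Adj (T.parent v) v := by
  rw [parent, dif_neg h]
  exact (T.existsUnique_parent v h).choose_spec.1

theorem parent_eq_of_adj {v w : V} (h : T.Adj v w) : T.parent w = v :=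
  (T.existsUnique_parent w (T.ne_root_of_adj h)).unique (T.parent_adj (T.ne_root_of_adj h)) h

theorem generation_unique {v : V} {m n : ℕ} (hm : v ∈ T.generation m) (hn : v ∈ T.generation n) :
    m = n := by
  induction m generalizing n v with
  | zero =>
    cases n with
    | zero => rfl
    | succ n =>
      obtain ⟨u, -, h⟩ := hn
      exact absurd hm (T.ne_root_of_adj h)
  | succ m ih =>
    obtain ⟨u, hu, h⟩ := hm
    cases n with
    | zero => exact absurd hn (T.ne_root_of_adj h)
    | succ n =>
      obtain ⟨u', hu', h'⟩ := hn
      rw [← T.parent_eq_of_adj h', T.parent_eq_of_adj h] at hu'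
      rw [ih hu hu']

theorem mem_generation_depth (v : V) : v ∈ T.generation (T.depth v) := by
  classical
  exact Nat.find_spec (T.exists_mem_generation v)

theorem depth_of_adj {v w : V} (h : T.Adj v w) : T.depth w = T.depth v + 1 :=
  T.generation_unique (T.mem_generation_depth w) ⟨v, T.mem_generation_depth v, h⟩

theorem depth_root : T.depth T.root = 0 :=
  T.generation_unique (T.mem_generation_depth _) rfl

/-- Beyond the branching index every vertex is the only child of its parent. -/
theorem children_parent_eq_singleton {N : ℕ} (hN : T.branchingIndex ≤ N) {v : V}
    (hv : N < T.depth v) : T.children (T.parent v) = {v} := by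
  have hr : v ≠ T.root := fun h => by rw [h, T.depth_root] at hv; omega
  have hp := T.parent_adj hr
  have hd := T.depth_of_adj hp
  have hs : (T.children (T.parent v)).Subsingleton := by
    rw [← Set.not_nontrivial_iff]
    intro hnt
    have h1 : ((T.depth (T.parent v) : ℕ∞) + 1) ≤ N :=
      le_trans (le_iSup₂ (f := fun w (_ : w ∈ {v : V | (T.children v).Nontrivial}) =>
        ((T.depth w : ℕ∞) + 1)) (T.parent v) hnt) hN
    have h2 : T.depth (T.parent v) + 1 ≤ N := by exact_mod_cast h1
    omega
  exact hs.eq_singleton_of_mem hp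

end RootedDirectedTree

/-! ### Multishifts whose norms depend only on the depth -/

namespace TreeProduct

variable {d : ℕ} {V : Fin d → Type*} (T : ∀ j, RootedDirectedTree (V j))

theorem ne_root_of_mem_chi {j : Fin d} {v w : ∀ i, V i} (h : w ∈ chi T j v) :
    w j ≠ (T j).root := by
  obtain ⟨η, hη, rfl⟩ := h
  rw [Function.update_self]
  exact (T j).ne_root_of_adj hη

theorem par_eq_of_mem_chi {j : Fin d} {v w : ∀ i, V i} (h : w ∈ chi T j v) : par T j w = v := by
  obtain ⟨η, hη, rfl⟩ := h
  simp [par, (T j).parent_eq_of_adj hη]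

theorem depth_of_mem_chi {j : Fin d} {v w : ∀ i, V i} (h : w ∈ chi T j v) :
    depth T w = depth T v + Pi.single j 1 := by
  obtain ⟨η, hη, rfl⟩ := h
  funext i
  by_cases hi : i = j
  · subst hi
    simp [depth, (T i).depth_of_adj hη]
  · simp [depth, hi]

theorem chi_eq_image (j : Fin d) (v : ∀ i, V i) :
    chi T j v = Function.update v j '' (T j).children (v j) := by
  ext w
  simp only [chi, Set.mem_image, Set.mem_ofPred_eq, eq_comm]

variable {T}

theorem finite_chi (hfin : ∀ j, (T j).LocallyFinite) (j : Fin d) (v : ∀ i, V i) :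
    (chi T j v).Finite := by
  rw [chi_eq_image]
  exact (hfin j _).image _

theorem ncard_chi_pos (hleaf : ∀ j, (T j).Leafless) (hfin : ∀ j, (T j).LocallyFinite) (j : Fin d)
    (v : ∀ i, V i) : 0 < (chi T j v).ncard := by
  rw [Set.ncard_pos (finite_chi hfin j v), chi_eq_image]
  exact (hleaf j _).image _

variable (T)

/-- `λ_j(w)^2 = κ_j(d_v) / card Chi_j(v)` for `w ∈ Chi_j(v)`, with `0 ≤ κ_j ≤ 1`. -/
structure IsBalanced (lam : Fin d → (∀ i, V i) → ℝ) (κ : Fin d → (Fin d → ℕ) → ℝ) : Prop where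
  nonneg : ∀ j β, 0 ≤ κ j β
  le_one : ∀ j β, κ j β ≤ 1
  sq_eq : ∀ j v, ∀ w ∈ chi T j v, lam j w ^ 2 = κ j (depth T v) / (chi T j v).ncard

variable {T} {lam : Fin d → (∀ i, V i) → ℝ} {κ : Fin d → (Fin d → ℕ) → ℝ}

theorem IsBalanced.weightBound (h : IsBalanced T lam κ) (hleaf : ∀ j, (T j).Leafless)
    (hfin : ∀ j, (T j).LocallyFinite) (j : Fin d) : WeightBound T lam j 1 := by
  refine ⟨zero_le_one, fun v s hs => ?_⟩
  have h0 : (0 : ℝ) < (chi T j v).ncard := by exact_mod_cast ncard_chi_pos hleaf hfin j v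
  have h1 : (s.card : ℝ) ≤ (chi T j v).ncard := by
    rw [← Set.ncard_coe_finset]
    exact_mod_cast Set.ncard_le_ncard hs (finite_chi hfin j v)
  rw [Finset.sum_congr rfl fun w hw => h.sq_eq j v w (hs hw), Finset.sum_const, nsmul_eq_mul,
    mul_div_left_comm]
  exact mul_le_one₀ (h.le_one _ _) (by positivity) ((div_le_one h0).2 h1)

/-- The bound chosen in `multishift` enters only the continuity estimate, not the values of the
operator. -/
theorem IsBalanced.multishift_apply (h : IsBalanced T lam κ) (hleaf : ∀ j, (T j).Leafless)
    (hfin : ∀ j, (T j).LocallyFinite) (j : Fin d) (f : SqSum (∀ i, V i)) (v : ∀ i, V i) :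
    multishift T lam j f v = shiftFun T lam j f v := by
  rw [multishift, dif_pos ⟨1, h.weightBound hleaf hfin j⟩]
  rfl

theorem shiftFun_of_mem_chi {j : Fin d} {u v : ∀ i, V i} (hv : v ∈ chi T j u)
    (f : (∀ i, V i) → ℂ) : shiftFun T lam j f v = lam j v * f u := by
  rw [shiftFun, if_neg (ne_root_of_mem_chi T hv), par_eq_of_mem_chi T hv]

/-- Each `v` passes its mass to `card Chi_j(v)` children in equal shares `κ_j / card Chi_j(v)`. The
test function `φ` of the depth is what makes the identity iterable; values in `ENNReal` avoid
summability conditions. -/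
theorem IsBalanced.tsum_shiftFun (h : IsBalanced T lam κ) (hleaf : ∀ j, (T j).Leafless)
    (hfin : ∀ j, (T j).LocallyFinite) (j : Fin d) (f : (∀ i, V i) → ℂ)
    (φ : (Fin d → ℕ) → ENNReal) :
    ∑' v, ‖shiftFun T lam j f v‖ₑ ^ 2 * φ (depth T v) =
      ∑' v, ‖f v‖ₑ ^ 2 *
        (ENNReal.ofReal (κ j (depth T v)) * φ (depth T v + Pi.single j 1)) := by
  classical
  -- At most one term of the inner sum is nonzero, that of the parent; this prepares the exchange of
  -- sums.
  have h1 : ∀ v, ‖shiftFun T lam j f v‖ₑ ^ 2 * φ (depth T v) =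
      ∑' u, if v ∈ chi T j u then
        ENNReal.ofReal (lam j v ^ 2) * (‖f u‖ₑ ^ 2 * φ (depth T u + Pi.single j 1)) else 0 := by
    intro v
    by_cases hv : v j = (T j).root
    · have : ∀ u, v ∉ chi T j u := fun u hu => ne_root_of_mem_chi T hu hv
      simp [shiftFun, hv, this]
    · have hm := mem_chi_par T hv
      rw [tsum_eq_single (par T j v) fun u hu => if_neg fun hc => hu (par_eq_of_mem_chi T hc).symm,
        if_pos hm, shiftFun_of_mem_chi hm, ← depth_of_mem_chi T hm, enorm_mul, mul_pow, mul_assoc]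
      congr 1
      rw [← ofReal_norm, Complex.norm_real, ← ENNReal.ofReal_pow (norm_nonneg _),
        Real.norm_eq_abs, sq_abs]
  simp_rw [h1]
  rw [ENNReal.tsum_comm]
  refine tsum_congr fun u => ?_
  have hf := finite_chi hfin j u
  have h0 := ncard_chi_pos hleaf hfin j u
  rw [tsum_eq_sum (s := hf.toFinset) fun v hv => if_neg (by simpa using hv)]
  rw [Finset.sum_congr rfl fun v hv => by
    rw [if_pos (hf.mem_toFinset.1 hv), h.sq_eq j u v (hf.mem_toFinset.1 hv)]]
  rw [Finset.sum_const, ← Set.ncard_eq_toFinset_card _ hf, nsmul_eq_mul, ← mul_assoc,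
    ← ENNReal.ofReal_natCast, ← ENNReal.ofReal_mul (by positivity),
    mul_div_cancel₀ _ (by exact_mod_cast h0.ne'), mul_left_comm]

theorem tsum_enorm_sq {X : Type*} (f : SqSum X) : ∑' v, ‖f v‖ₑ ^ 2 = ‖f‖ₑ ^ 2 := by
  have h := lp.hasSum_norm (p := 2) (by norm_num) f
  simp only [ENNReal.toReal_ofNat, Real.rpow_two] at h
  rw [← ofReal_norm f, ← ENNReal.ofReal_pow (norm_nonneg _), ← h.tsum_eq,
    ENNReal.ofReal_tsum_of_nonneg (fun _ => by positivity) h.summable]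
  simp [ENNReal.ofReal_pow]

open Classical in
theorem IsBalanced.norm_multishift_single_sq (h : IsBalanced T lam κ)
    (hleaf : ∀ j, (T j).Leafless) (hfin : ∀ j, (T j).LocallyFinite) (j : Fin d) (v : ∀ i, V i) :
    ‖multishift T lam j (lp.single 2 v (1 : ℂ))‖ ^ 2 = κ j (depth T v) := by
  have h1 := h.tsum_shiftFun hleaf hfin j (lp.single 2 v (1 : ℂ) : SqSum _) fun _ => 1
  simp only [← h.multishift_apply hleaf hfin, mul_one] at h1
  rw [tsum_enorm_sq, tsum_eq_single v fun w hw => by simp [lp.single_apply, hw]] at h1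
  rw [← ofReal_norm, ← ENNReal.ofReal_pow (norm_nonneg _)] at h1
  simp only [lp.single_apply_self, enorm_one, one_pow, one_mul] at h1
  exact (ENNReal.ofReal_eq_ofReal_iff (by positivity) (h.nonneg _ _)).1 h1

variable (T) in
theorem isBalanced_druryArvesonWeight {a : ℕ} (ha : 0 < a) (hd : 0 < d) :
    IsBalanced T (druryArvesonWeight T a)
      fun j β => ((β j : ℝ) + 1) / (((∑ i, β i : ℕ) : ℝ) + a) where
  nonneg j β := by positivity
  le_one j β := by
    have h1 : (β j : ℝ) ≤ ((∑ i, β i : ℕ) : ℝ) := by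
      exact_mod_cast Finset.single_le_sum (f := β) (fun _ _ => Nat.zero_le _) (Finset.mem_univ j)
    have h2 : (1 : ℝ) ≤ a := by exact_mod_cast ha
    rw [div_le_one (by positivity)]
    linarith
  sq_eq j v w hw := by
    rw [druryArvesonWeight, balancedWeight, par_eq_of_mem_chi T hw, mul_pow,
      Real.sq_sqrt (by positivity), Real.sq_sqrt (by positivity)]
    simp only [level]
    field_simp

/-- Summing `(β_i + 1) / (|β| + a)` over `i` gives `(|β| + d) / (|β| + a)`, and the dual divides by
it. -/
theorem cauchyDualWeight_druryArvesonWeight {a : ℕ} (ha : 0 < a) (hd : 0 < d)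
    (hleaf : ∀ j, (T j).Leafless) (hfin : ∀ j, (T j).LocallyFinite) {j : Fin d} {v w : ∀ i, V i}
    (hw : w ∈ chi T j v) :
    cauchyDualWeight T (druryArvesonWeight T a) j w = druryArvesonWeight T a j w *
      ((((∑ i, depth T v i : ℕ) : ℝ) + a) / (((∑ i, depth T v i : ℕ) : ℝ) + d)) := by
  rw [cauchyDualWeight, par_eq_of_mem_chi T hw]
  simp only [(isBalanced_druryArvesonWeight T ha hd).norm_multishift_single_sq hleaf hfin]
  rw [← Finset.sum_div, Finset.sum_add_distrib]
  simp

/-- `‖S_j e_v‖^2` for the spherical Cauchy dual of the Drury-Arveson-type multishift and a vertex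
`v` of depth `β`. -/
noncomputable def dualCoeff (a : ℕ) {d : ℕ} (j : Fin d) (β : Fin d → ℕ) : ℝ :=
  ((β j : ℝ) + 1) * (((∑ i, β i : ℕ) : ℝ) + a) / (((∑ i, β i : ℕ) : ℝ) + d) ^ 2

theorem isBalanced_cauchyDualWeight {a : ℕ} (ha : 0 < a) (had : a < d)
    (hleaf : ∀ j, (T j).Leafless) (hfin : ∀ j, (T j).LocallyFinite) :
    IsBalanced T (cauchyDualWeight T (druryArvesonWeight T a)) (dualCoeff a) where
  nonneg j β := by unfold dualCoeff; positivity
  le_one j β := by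
    have hd := ha.trans had
    have h1 : (β j : ℝ) ≤ ((∑ i, β i : ℕ) : ℝ) := by
      exact_mod_cast Finset.single_le_sum (f := β) (fun _ _ => Nat.zero_le _) (Finset.mem_univ j)
    have h2 : (1 : ℝ) ≤ d := by exact_mod_cast hd
    have h3 : (a : ℝ) ≤ d := by exact_mod_cast had.le
    rw [dualCoeff, div_le_one (by positivity), sq]
    gcongr
  sq_eq j v w hw := by
    have hd := ha.trans had
    rw [cauchyDualWeight_druryArvesonWeight ha hd hleaf hfin hw, mul_pow,
      (isBalanced_druryArvesonWeight T ha hd).sq_eq j v w hw, dualCoeff]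
    field_simp

theorem cauchyDualWeight_ne_zero {a : ℕ} (ha : 0 < a) (had : a < d)
    (hleaf : ∀ j, (T j).Leafless) (hfin : ∀ j, (T j).LocallyFinite) {j : Fin d} {v w : ∀ i, V i}
    (hw : w ∈ chi T j v) : cauchyDualWeight T (druryArvesonWeight T a) j w ≠ 0 := by
  have h := (isBalanced_cauchyDualWeight ha had hleaf hfin).sq_eq j v w hw
  have h0 : (0 : ℝ) < (chi T j v).ncard := by exact_mod_cast ncard_chi_pos hleaf hfin j v
  have hd := ha.trans had
  intro hz
  rw [hz, dualCoeff] at h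
  exact absurd h (ne_of_lt (by rw [zero_pow two_ne_zero]; positivity))

end TreeProduct

/-! ### Moments of the powers of the Cauchy dual -/

open TreeProduct

theorem dualMoment_zero (a : ℕ) {d : ℕ} (β : Fin d → ℕ) : dualMoment a 0 β = 1 := by
  simp [dualMoment]

theorem dualMoment_nonneg (a : ℕ) {d : ℕ} (α β : Fin d → ℕ) : 0 ≤ dualMoment a α β := by
  unfold dualMoment
  positivity

theorem dualMoment_single (a : ℕ) {d : ℕ} (j : Fin d) (β : Fin d → ℕ) :
    dualMoment a (Pi.single j 1) β = dualCoeff a j β := by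
  classical
  rw [dualMoment, Finset.prod_eq_single j (fun i _ hi => by simp [hi]) (by simp)]
  simp [dualCoeff, mul_div_assoc]

/-- A cocycle identity: going up by `α` and then by `α'` from depth `β + α`. It mirrors composition
of operators. -/
theorem dualMoment_add (a : ℕ) {d : ℕ} (α α' β : Fin d → ℕ) :
    dualMoment a (α + α') β = dualMoment a α β * dualMoment a α' (β + α) := by
  simp only [dualMoment, Pi.add_apply, Finset.sum_add_distrib, Finset.prod_range_add,
    Finset.prod_mul_distrib]
  push_cast
  simp only [add_assoc, add_comm]
  ring

namespace TreeProduct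

variable {d : ℕ} {V : Fin d → Type*} (T : ∀ j, RootedDirectedTree (V j))

/-- `A` raises the depth by `α`, and `‖A e_v‖^2` is `dualMoment a α d_v`. -/
def HasDualMoment (a : ℕ) (α : Fin d → ℕ) (A : SqSum (∀ i, V i) →L[ℂ] SqSum (∀ i, V i)) : Prop :=
  ∀ (f : SqSum (∀ i, V i)) (φ : (Fin d → ℕ) → ENNReal),
    ∑' v, ‖A f v‖ₑ ^ 2 * φ (depth T v) =
      ∑' v, ‖f v‖ₑ ^ 2 * (ENNReal.ofReal (dualMoment a α (depth T v)) * φ (depth T v + α))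

variable {T}

theorem HasDualMoment.one (a : ℕ) : HasDualMoment T a 0 1 := fun f φ => by
  simp [dualMoment_zero]

/-- The test function produced by `A` serves as the test function for `B`; the cocycle identity
combines the factors. -/
theorem HasDualMoment.mul {a : ℕ} {α α' : Fin d → ℕ}
    {A B : SqSum (∀ i, V i) →L[ℂ] SqSum (∀ i, V i)} (hA : HasDualMoment T a α A)
    (hB : HasDualMoment T a α' B) : HasDualMoment T a (α + α') (A * B) := fun f φ => by
  simp only [mul_apply_eq_comp]
  rw [hA, hB f fun β => ENNReal.ofReal (dualMoment a α β) * φ (β + α)]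
  refine tsum_congr fun v => ?_
  rw [add_comm α, dualMoment_add, ENNReal.ofReal_mul (dualMoment_nonneg _ _ _), mul_assoc,
    add_assoc]

theorem HasDualMoment.pow {a : ℕ} {α : Fin d → ℕ}
    {A : SqSum (∀ i, V i) →L[ℂ] SqSum (∀ i, V i)} (hA : HasDualMoment T a α A) (n : ℕ) :
    HasDualMoment T a (n • α) (A ^ n) := by
  induction n with
  | zero => simpa using HasDualMoment.one a
  | succ n ih => rw [succ_nsmul, pow_succ]; exact ih.mul hA

theorem HasDualMoment.list_prod {a n : ℕ} {α : Fin n → Fin d → ℕ}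
    {A : Fin n → SqSum (∀ i, V i) →L[ℂ] SqSum (∀ i, V i)}
    (hA : ∀ i, HasDualMoment T a (α i) (A i)) :
    HasDualMoment T a (∑ i, α i) (List.ofFn A).prod := by
  induction n with
  | zero => simpa using HasDualMoment.one a
  | succ n ih =>
    rw [List.ofFn_succ, List.prod_cons, Fin.sum_univ_succ]
    exact (hA 0).mul (ih fun i => hA i.succ)

theorem hasDualMoment_multishift {a : ℕ} (ha : 0 < a) (had : a < d)
    (hleaf : ∀ j, (T j).Leafless) (hfin : ∀ j, (T j).LocallyFinite) (j : Fin d) :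
    HasDualMoment T a (Pi.single j 1)
      (multishift T (cauchyDualWeight T (druryArvesonWeight T a)) j) := fun f φ => by
  have h := isBalanced_cauchyDualWeight ha had hleaf hfin
  simp only [h.multishift_apply hleaf hfin, dualMoment_single]
  exact h.tsum_shiftFun hleaf hfin j f φ

theorem hasDualMoment_tuplePow {a : ℕ} (ha : 0 < a) (had : a < d)
    (hleaf : ∀ j, (T j).Leafless) (hfin : ∀ j, (T j).LocallyFinite) (α : Fin d → ℕ) :
    HasDualMoment T a α
      (tuplePow (multishift T (cauchyDualWeight T (druryArvesonWeight T a))) α) := by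
  have h := HasDualMoment.list_prod fun j =>
    (hasDualMoment_multishift ha had hleaf hfin j).pow (α j)
  have e : ∑ j, α j • (Pi.single j 1 : Fin d → ℕ) = α := by
    funext i
    simp [Finset.sum_apply, Pi.single_apply]
  rwa [e] at h

end TreeProduct

/-! ### Depth projections and the joint cokernel -/

namespace TreeProduct

variable {d : ℕ} {V : Fin d → Type*} (T : ∀ j, RootedDirectedTree (V j))

open Classical in
/-- The projection of `l^2(V)` onto the functions supported on the vertices with depth in `s`. -/
noncomputable def depthProj (s : Set (Fin d → ℕ)) : SqSum (∀ i, V i) →L[ℂ] SqSum (∀ i, V i) :=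
  LinearMap.mkContinuous
    { toFun := fun f => (⟨fun v => if depth T v ∈ s then f v else 0,
        (lp.memℓp f).mono' (fun v => by split_ifs <;> simp)⟩ : SqSum (∀ i, V i))
      map_add' := fun f g => by
        ext v
        change (if depth T v ∈ s then (f + g : SqSum _) v else 0) =
          (if depth T v ∈ s then f v else 0) + (if depth T v ∈ s then g v else 0)
        split_ifs <;> simp
      map_smul' := fun c f => by
        ext v
        change (if depth T v ∈ s then (c • f : SqSum _) v else 0) =
          c • (if depth T v ∈ s then f v else 0)
        split_ifs <;> simp }
    1 fun f => by
      rw [one_mul]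
      refine lp.norm_mono (p := 2) (by norm_num) fun v => ?_
      change ‖if depth T v ∈ s then f v else 0‖ ≤ ‖f v‖
      split_ifs <;> simp

open Classical in
theorem depthProj_apply (s : Set (Fin d → ℕ)) (f : SqSum (∀ i, V i)) (v : ∀ i, V i) :
    depthProj T s f v = if depth T v ∈ s then f v else 0 := rfl

theorem inner_depthProj (s : Set (Fin d → ℕ)) (f g : SqSum (∀ i, V i)) :
    inner ℂ (depthProj T s f) g = inner ℂ f (depthProj T s g) := by
  rw [lp.inner_eq_tsum, lp.inner_eq_tsum]
  refine tsum_congr fun v => ?_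
  simp only [depthProj_apply]
  split_ifs <;> simp

theorem depthProj_depthProj (s : Set (Fin d → ℕ)) (f : SqSum (∀ i, V i)) :
    depthProj T s (depthProj T s f) = depthProj T s f := by
  ext v
  simp only [depthProj_apply]
  split_ifs <;> rfl

variable {T} {lam : Fin d → (∀ i, V i) → ℝ} {κ : Fin d → (Fin d → ℕ) → ℝ}

/-- Stated for sets of depths because the preimage of a single depth under adding `e_j` may be
empty. -/
theorem IsBalanced.depthProj_multishift (h : IsBalanced T lam κ) (hleaf : ∀ j, (T j).Leafless)
    (hfin : ∀ j, (T j).LocallyFinite) (j : Fin d) (s : Set (Fin d → ℕ)) (f : SqSum (∀ i, V i)) :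
    depthProj T s (multishift T lam j f) =
      multishift T lam j (depthProj T ((· + Pi.single j 1) ⁻¹' s) f) := by
  ext v
  rw [depthProj_apply, h.multishift_apply hleaf hfin, h.multishift_apply hleaf hfin]
  by_cases hv : v j = (T j).root
  · simp [shiftFun, hv]
  · have hm := mem_chi_par T hv
    rw [shiftFun_of_mem_chi hm, shiftFun_of_mem_chi hm, depthProj_apply, depth_of_mem_chi T hm]
    rw [mul_ite, mul_zero]
    rfl

/-- With `P'` the projection for the shifted set, `⟨S_j g, P f⟩ = ⟨P S_j g, f⟩ = ⟨S_j P' g, f⟩ = 0`.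
-/
theorem IsBalanced.depthProj_mem_jointCokernel (h : IsBalanced T lam κ)
    (hleaf : ∀ j, (T j).Leafless) (hfin : ∀ j, (T j).LocallyFinite) (s : Set (Fin d → ℕ))
    {f : SqSum (∀ i, V i)} (hf : f ∈ jointCokernel (multishift T lam)) :
    depthProj T s f ∈ jointCokernel (multishift T lam) := by
  simp only [jointCokernel, Submodule.mem_iInf, LinearMap.mem_ker] at hf ⊢
  intro j
  refine ext_inner_left ℂ fun g => ?_
  have hj : ContinuousLinearMap.adjoint (multishift T lam j) f = 0 := hf j
  change inner ℂ g (ContinuousLinearMap.adjoint (multishift T lam j) (depthProj T s f)) = _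
  rw [ContinuousLinearMap.adjoint_inner_right, ← inner_depthProj,
    h.depthProj_multishift hleaf hfin, ← ContinuousLinearMap.adjoint_inner_right, hj,
    inner_zero_right, inner_zero_right]

/-- Vertices that are the only child of their parent do not carry elements of the joint cokernel. -/
theorem IsBalanced.eq_zero_of_chi_eq_singleton (h : IsBalanced T lam κ)
    (hleaf : ∀ j, (T j).Leafless) (hfin : ∀ j, (T j).LocallyFinite) {f : SqSum (∀ i, V i)}
    (hf : f ∈ jointCokernel (multishift T lam)) {j : Fin d} {u v : ∀ i, V i}
    (huv : chi T j u = {v}) (hlam : lam j v ≠ 0) : f v = 0 := by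
  classical
  simp only [jointCokernel, Submodule.mem_iInf, LinearMap.mem_ker] at hf
  have hj : ContinuousLinearMap.adjoint (multishift T lam j) f = 0 := hf j
  -- With a single child, `S_j e_u` is a multiple of `e_v`, so orthogonality to it kills `f v`.
  have hs : multishift T lam j (lp.single 2 u (1 : ℂ)) = lp.single 2 v (lam j v : ℂ) := by
    ext w
    rw [h.multishift_apply hleaf hfin]
    by_cases hw : w = v
    · subst hw
      rw [shiftFun_of_mem_chi (u := u) (by simp [huv])]
      simp
    · rw [lp.single_apply_ne _ _ _ hw, shiftFun]
      split_ifs with hr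
      · rfl
      · have hp : par T j w ≠ u := fun e => hw (by simpa [e, huv] using mem_chi_par T hr)
        rw [lp.single_apply_ne _ _ _ hp, mul_zero]
  have h1 : inner ℂ (multishift T lam j (lp.single 2 u (1 : ℂ))) f = 0 := by
    rw [← ContinuousLinearMap.adjoint_inner_right, hj, inner_zero_right]
  rw [hs, lp.inner_single_left] at h1
  simpa [hlam] using h1

theorem chi_par_eq_singleton {j : Fin d} {N : ℕ} (hN : (T j).branchingIndex ≤ N) {v : ∀ i, V i}
    (hv : N < depth T v j) : chi T j (par T j v) = {v} := by
  rw [chi_eq_image]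
  simp only [par, Function.update_self, Function.update_idem]
  rw [(T j).children_parent_eq_singleton hN hv]
  simp

theorem FiniteJointBranchingIndex.exists_bound (hbr : FiniteJointBranchingIndex T) :
    ∃ N : Fin d → ℕ, ∀ j, (T j).branchingIndex ≤ N j :=
  ⟨fun j => ((T j).branchingIndex).toNat, fun j => by rw [ENat.natCast_toNat (hbr j)]⟩

/-- Finite branching confines the joint cokernel to the finitely many depths `β ≤ N`. -/
theorem IsBalanced.eq_zero_of_not_depth_le (h : IsBalanced T lam κ)
    (hleaf : ∀ j, (T j).Leafless) (hfin : ∀ j, (T j).LocallyFinite)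
    (hlam : ∀ j v, ∀ w ∈ chi T j v, lam j w ≠ 0) {N : Fin d → ℕ}
    (hN : ∀ j, (T j).branchingIndex ≤ N j) {f : SqSum (∀ i, V i)}
    (hf : f ∈ jointCokernel (multishift T lam)) {v : ∀ i, V i} (hv : ¬ depth T v ≤ N) :
    f v = 0 := by
  obtain ⟨j, hj⟩ := not_forall.1 hv
  have hc := chi_par_eq_singleton (hN j) (not_le.1 hj)
  exact h.eq_zero_of_chi_eq_singleton hleaf hfin hf hc (hlam j _ _ (by rw [hc]; rfl))

theorem depth_eq_of_mem_sibF {F : Finset (Fin d)} {u v : ∀ i, V i} (hu : u ∈ phi T F)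
    (hv : v ∈ sibF T F u) : depth T v = depth T u := by
  funext j
  by_cases hj : j ∈ F
  · have h1 := (T j).depth_of_adj (hv.1 j hj)
    have h2 := (T j).depth_of_adj ((T j).parent_adj (hu.1 j hj))
    exact h1.trans h2.symm
  · simp [depth, hv.2 j hj]

/-- The restriction of `depthProj T {β}` to the joint cokernel. -/
noncomputable def IsBalanced.cokernelProj (h : IsBalanced T lam κ) (hleaf : ∀ j, (T j).Leafless)
    (hfin : ∀ j, (T j).LocallyFinite) (β : Fin d → ℕ) :
    jointCokernel (multishift T lam) →L[ℂ] jointCokernel (multishift T lam) :=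
  ((depthProj T {β}).comp (jointCokernel (multishift T lam)).subtypeL).codRestrict _ fun f =>
    h.depthProj_mem_jointCokernel hleaf hfin {β} f.2

section cokernelProj

variable (h : IsBalanced T lam κ) (hleaf : ∀ j, (T j).Leafless) (hfin : ∀ j, (T j).LocallyFinite)

theorem IsBalanced.coe_cokernelProj (β : Fin d → ℕ) (f : jointCokernel (multishift T lam)) :
    (h.cokernelProj hleaf hfin β f : SqSum (∀ i, V i)) = depthProj T {β} f := rfl

theorem IsBalanced.inner_cokernelProj (β : Fin d → ℕ) (f g : jointCokernel (multishift T lam)) :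
    inner ℂ (h.cokernelProj hleaf hfin β f) g = inner ℂ f (h.cokernelProj hleaf hfin β g) :=
  inner_depthProj T {β} f g

theorem IsBalanced.inner_self_cokernelProj (β : Fin d → ℕ)
    (f : jointCokernel (multishift T lam)) :
    inner ℂ f (h.cokernelProj hleaf hfin β f) = ((‖depthProj T {β} f‖ ^ 2 : ℝ) : ℂ) := by
  change inner ℂ (f : SqSum _) (depthProj T {β} f) = _
  rw [← depthProj_depthProj, ← inner_depthProj, inner_self_eq_norm_sq_to_K, depthProj_depthProj]
  norm_cast

theorem IsBalanced.isPositive_cokernelProj (β : Fin d → ℕ) :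
    (h.cokernelProj hleaf hfin β).IsPositive := by
  refine ⟨h.inner_cokernelProj hleaf hfin β, fun f => ?_⟩
  rw [ContinuousLinearMap.reApplyInnerSelf_apply, h.inner_cokernelProj,
    h.inner_self_cokernelProj]
  exact sq_nonneg ‖depthProj T {β} f‖

theorem IsBalanced.sum_cokernelProj (hlam : ∀ j v, ∀ w ∈ chi T j v, lam j w ≠ 0)
    {N : Fin d → ℕ} (hN : ∀ j, (T j).branchingIndex ≤ N j)
    (f : jointCokernel (multishift T lam)) :
    ∑ β ∈ Finset.Iic N, h.cokernelProj hleaf hfin β f = f := by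
  classical
  ext v
  simp only [Submodule.coe_sum, lp.coeFn_sum, Finset.sum_apply, h.coe_cokernelProj,
    depthProj_apply, Set.mem_singleton_iff, Finset.sum_ite_eq, Finset.mem_Iic]
  split_ifs with hv
  · rfl
  · exact (h.eq_zero_of_not_depth_le hleaf hfin hlam hN f.2 hv).symm

end cokernelProj

/-- Take `φ = 1` and group the vertices by depth; depths outside `β ≤ N` carry nothing. -/
theorem IsBalanced.norm_sq_eq_sum (h : IsBalanced T lam κ) (hleaf : ∀ j, (T j).Leafless)
    (hfin : ∀ j, (T j).LocallyFinite) {a : ℕ} {α : Fin d → ℕ}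
    {A : SqSum (∀ i, V i) →L[ℂ] SqSum (∀ i, V i)} (hA : HasDualMoment T a α A)
    (hlam : ∀ j v, ∀ w ∈ chi T j v, lam j w ≠ 0)
    {N : Fin d → ℕ} (hN : ∀ j, (T j).branchingIndex ≤ N j)
    (f : jointCokernel (multishift T lam)) :
    ‖A f‖ ^ 2 = ∑ β ∈ Finset.Iic N, ‖depthProj T {β} f‖ ^ 2 * dualMoment a α β := by
  classical
  have h1 := hA f fun _ => 1
  simp only [mul_one] at h1
  rw [tsum_enorm_sq] at h1
  have h2 : ∀ v, ‖(f : SqSum (∀ i, V i)) v‖ₑ ^ 2 * ENNReal.ofReal (dualMoment a α (depth T v)) =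
      ∑ β ∈ Finset.Iic N, ‖depthProj T {β} f v‖ₑ ^ 2 * ENNReal.ofReal (dualMoment a α β) := by
    intro v
    by_cases hv : depth T v ≤ N
    · rw [Finset.sum_eq_single_of_mem (depth T v) (Finset.mem_Iic.2 hv) fun β _ hβ => by
        simp [depthProj_apply, hβ.symm]]
      simp [depthProj_apply]
    · rw [Finset.sum_eq_zero fun β hβ => by
        have : depth T v ≠ β := fun e => hv (e ▸ Finset.mem_Iic.1 hβ)
        simp [depthProj_apply, this]]
      simp [h.eq_zero_of_not_depth_le hleaf hfin hlam hN f.2 hv]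
  simp_rw [h2] at h1
  rw [Summable.tsum_finsetSum fun _ _ => ENNReal.summable] at h1
  simp_rw [ENNReal.tsum_mul_right, tsum_enorm_sq, ← ofReal_norm,
    ← ENNReal.ofReal_pow (norm_nonneg _), ← ENNReal.ofReal_mul (sq_nonneg _)] at h1
  rw [← ENNReal.ofReal_sum_of_nonneg fun β _ =>
    mul_nonneg (sq_nonneg _) (dualMoment_nonneg _ _ _)] at h1
  exact (ENNReal.ofReal_eq_ofReal_iff (sq_nonneg _) (Finset.sum_nonneg fun β _ =>
    mul_nonneg (sq_nonneg _) (dualMoment_nonneg _ _ _))).1 h1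

end TreeProduct

/-! ### Norms in the model and finite operator-valued measures -/

theorem AnalyticModel.norm_monomial_sq {d : ℕ} {K : Type*} [NormedAddCommGroup K]
    [InnerProductSpace ℂ K] [CompleteSpace K] {S : Fin d → K →L[ℂ] K} (α : Fin d → ℕ)
    (f : jointCokernel S) :
    ‖AnalyticModel.monomial α f‖ ^ 2 = ‖tuplePow S α (f : K)‖ ^ 2 := by
  classical
  have hc : (AnalyticModel.monomial α f).coeff = Pi.single α f := by
    refine AnalyticModel.coeff_eq ⟨fun z => ?_, summable_of_ne_finset_zero (s := {α}) fun β hβ => ?_⟩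
    · have := hasSum_single
        (f := fun β => zpowMulti z.1 β • (Pi.single α f : _ → jointCokernel S) β)
        α fun β hβ => by simp [hβ]
      rw [Pi.single_eq_same] at this
      exact this
    · have : β ≠ α := by simpa using hβ
      simp [this]
  have h : inner ℂ (AnalyticModel.monomial α f) (AnalyticModel.monomial α f) =
      ∑' β, inner ℂ (tuplePow S β ((AnalyticModel.monomial α f).coeff β : K))
        (tuplePow S β ((AnalyticModel.monomial α f).coeff β : K)) := rfl
  rw [hc, tsum_eq_single α fun β hβ => by simp [hβ], Pi.single_eq_same,
    inner_self_eq_norm_sq_to_K, inner_self_eq_norm_sq_to_K] at h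
  exact_mod_cast h

/-- `A ↦ ∑_{i ∈ s} m_i(A) P_i`. -/
noncomputable def sumSMulMeasure {X ι H : Type*} [MeasurableSpace X] [NormedAddCommGroup H]
    [NormedSpace ℂ H] (s : Finset ι) (m : ι → Measure X) [∀ i, IsFiniteMeasure (m i)]
    (P : ι → H →L[ℂ] H) : VectorMeasure X (H →L[ℂ] H) :=
  ∑ i ∈ s, (m i).toSignedMeasure.mapRange
    (((ContinuousLinearMap.toSpanSingleton ℝ (P i)).toLinearMap).toAddMonoidHom)
    (ContinuousLinearMap.toSpanSingleton ℝ (P i)).continuous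

theorem sumSMulMeasure_apply {X ι H : Type*} [MeasurableSpace X] [NormedAddCommGroup H]
    [NormedSpace ℂ H] (s : Finset ι) (m : ι → Measure X) [∀ i, IsFiniteMeasure (m i)]
    (P : ι → H →L[ℂ] H) {A : Set X} (hA : MeasurableSet A) :
    sumSMulMeasure s m P A = ∑ i ∈ s, (((m i).real A : ℝ) : ℂ) • P i := by
  simp [sumSMulMeasure, Measure.toSignedMeasure_apply_measurable hA]

/-- Reduces integration against the operator measure to the scalar measures `m i`. -/
theorem scalarMeasure_sumSMulMeasure {X ι H : Type*} [MeasurableSpace X] [NormedAddCommGroup H]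
    [InnerProductSpace ℂ H] (s : Finset ι) (m : ι → Measure X) [∀ i, IsFiniteMeasure (m i)]
    (P : ι → H →L[ℂ] H) (f : H) :
    scalarMeasure (sumSMulMeasure s m P) f =
      ∑ i ∈ s, (inner ℂ f (P i f)).re • (m i).toSignedMeasure := by
  ext A hA
  simp [scalarMeasure, sumSMulMeasure_apply s m P hA,
    Measure.toSignedMeasure_apply_measurable hA, mul_comm]

theorem integral_scalarMeasure_sumSMulMeasure {X ι H : Type*} [MeasurableSpace X]
    [NormedAddCommGroup H] [InnerProductSpace ℂ H] (s : Finset ι) (m : ι → Measure X)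
    [∀ i, IsFiniteMeasure (m i)] (P : ι → H →L[ℂ] H) (f : H) {g : X → ℝ}
    (hg : ∀ i ∈ s, Integrable g (m i)) :
    (scalarMeasure (sumSMulMeasure s m P) f).Integrable g ∧
      ∫ᵛ x, g x ∂•(scalarMeasure (sumSMulMeasure s m P) f) =
        ∑ i ∈ s, (inner ℂ f (P i f)).re * ∫ x, g x ∂(m i) := by
  have hi : ∀ i ∈ s,
      ((inner ℂ f (P i f)).re • (m i).toSignedMeasure : SignedMeasure X).Integrable g :=
    fun i hi => VectorMeasure.Integrable.smul_vectorMeasure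
      (by simpa [VectorMeasure.Integrable] using hg i hi) _
  rw [scalarMeasure_sumSMulMeasure]
  refine ⟨VectorMeasure.Integrable.finsetSum_vectorMeasure hi, ?_⟩
  rw [VectorMeasure.integral_finsetSum_vectorMeasure hi]
  refine Finset.sum_congr rfl fun i _ => ?_
  -- Multiplication on `ℝ` is commutative; the flip matches the pairing in
  -- `integral_toSignedMeasure`.
  have hflip : ContinuousLinearMap.lsmul ℝ ℝ (E := ℝ) = (ContinuousLinearMap.lsmul ℝ ℝ).flip := by
    ext
    simp
  rw [VectorMeasure.integral_smul_vectorMeasure, smul_eq_mul, hflip,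
    VectorMeasure.integral_toSignedMeasure]

/-! ### The representing measure -/

open TreeProduct in
theorem corollary2p11 {d : ℕ} {V : Fin d → Type*} (T : ∀ j, RootedDirectedTree (V j))
    (hleaf : ∀ j, (T j).Leafless) (hfin : ∀ j, (T j).LocallyFinite)
    (hbr : TreeProduct.FiniteJointBranchingIndex T)
    (Om : Finset (Fin d) → Set (∀ i, V i)) (hOm : ∀ F, TreeProduct.IsIndexingSet T F (Om F))
    (a : ℕ) (ha : 0 < a) (had : a < d) :
    (∀ (l : ℕ), ∀ s ∈ Set.Icc (0 : ℝ) 1, 0 ≤ omegaWeight a d l s) ∧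
    ∃ μ, IsRepresentingMeasure T
      (TreeProduct.cauchyDualWeight T (TreeProduct.druryArvesonWeight T a)) Om 1 μ
      (fun u => radialMeasure a d (TreeProduct.level T u))
      (fun u => sphericalMeasure d (TreeProduct.depth T u)) := by
  refine ⟨fun l s hs => omegaWeight_nonneg ha had l hs, ?_⟩
  have hd := ha.trans had
  obtain ⟨N, hN⟩ := hbr.exists_bound
  have hbal := isBalanced_cauchyDualWeight (T := T) ha had hleaf hfin
  have hlam : ∀ j v, ∀ w ∈ chi T j v, cauchyDualWeight T (druryArvesonWeight T a) j w ≠ 0 :=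
    fun j v w hw => cauchyDualWeight_ne_zero ha had hleaf hfin hw
  let m : (Fin d → ℕ) → Measure (ℝ × CSphere d) := fun β =>
    (radialMeasure a d (∑ i, β i)).prod (sphericalMeasure d β)
  let P := hbal.cokernelProj hleaf hfin
  have : ∀ β, IsFiniteMeasure (m β) := fun β => inferInstanceAs (IsFiniteMeasure (Measure.prod _ _))
  refine ⟨sumSMulMeasure (Finset.Iic N) m P, ?_⟩
  refine ⟨one_pos, fun A hA hdisj => ?_, fun A => ?_, fun F u _ => inferInstance,
    fun F u _ => inferInstance, fun f α => ?_, fun A hA g f hg hsum => ?_,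
    isProbabilityMeasure_radialMeasure ha had _, isProbabilityMeasure_sphericalMeasure hd _⟩
  · rw [sumSMulMeasure_apply _ _ _ hA]
    refine Finset.sum_eq_zero fun β _ => ?_
    have h0 : m β A = 0 := by
      refine measure_mono_null (t := (Set.Icc (0 : ℝ) 1)ᶜ ×ˢ Set.univ) (fun p hp => ⟨fun hc =>
        Set.disjoint_left.1 hdisj hp ⟨hc, trivial⟩, trivial⟩) ?_
      rw [Measure.prod_prod, radialMeasure_eq_zero _ _ _ disjoint_compl_left, zero_mul]
    simp [Measure.real, h0]
  · by_cases hA : MeasurableSet A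
    · rw [sumSMulMeasure_apply _ _ _ hA]
      refine ContinuousLinearMap.isPositive_sum _ fun β _ => ?_
      exact (hbal.isPositive_cokernelProj hleaf hfin β).smul_of_nonneg
        (Complex.zero_le_real.2 measureReal_nonneg)
    -- Vector measures take the default value `0` on non-measurable sets.
    · rw [VectorMeasure.not_measurable _ hA]
      exact ContinuousLinearMap.isPositive_zero
  · obtain ⟨h1, h2⟩ := integral_scalarMeasure_sumSMulMeasure (Finset.Iic N) m P f
      (g := fun p : ℝ × CSphere d => p.1 ^ (∑ i, α i) * ‖zpowMulti p.2.1 α‖ ^ 2)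
      fun β _ => integrable_prod_radial_spherical ha had α β
    refine ⟨h1, ?_⟩
    rw [h2, AnalyticModel.norm_monomial_sq, hbal.norm_sq_eq_sum hleaf hfin
      (hasDualMoment_tuplePow ha had hleaf hfin α) hlam hN]
    refine Finset.sum_congr rfl fun β _ => ?_
    rw [integral_prod_radial_spherical ha had, hbal.inner_self_cokernelProj, Complex.ofReal_re]
  · have hdiag : ∀ p : (F : Finset (Fin d)) × Om F,
        sumSMulMeasure (Finset.Iic N) m P A (g p.1 p.2) =
          (((radialMeasure a d (level T p.2.1)).prod
            (sphericalMeasure d (depth T p.2.1))).real A : ℂ) • g p.1 p.2 := by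
      rintro ⟨F, u⟩
      -- `g F u` is supported on `sib_F(u)`, where every vertex has depth `d_u`.
      have hP : ∀ β, β ≠ depth T u.1 → P β (g F u) = 0 := fun β hβ => by
        ext v
        have hc := hbal.coe_cokernelProj hleaf hfin β (g F u)
        rw [hc, depthProj_apply]
        split_ifs with hv
        · refine (hg F u).1 v fun hm => hβ ?_
          rw [← depth_eq_of_mem_sibF ((hOm F).1 u.2) hm]
          exact hv.symm
        · rfl
      -- Splitting the right-hand side by depth allows a termwise comparison and avoids deciding
      -- whether `d_u ≤ N`.
      conv_rhs => rw [← hbal.sum_cokernelProj hleaf hfin hlam hN (g F u), Finset.smul_sum]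
      rw [sumSMulMeasure_apply _ _ _ hA, sum_apply]
      refine Finset.sum_congr rfl fun β _ => ?_
      rw [smul_apply]
      by_cases hβ : β = depth T u.1
      · subst hβ; rfl
      · have h0 := hP β hβ
        change _ • P β (g F u) = _ • P β (g F u)
        rw [h0, smul_zero, smul_zero]
    simpa only [hdiag] using hsum.mapL (sumSMulMeasure (Finset.Iic N) m P A)
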